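/- Let $\mathbb T=\mathbb R/2\pi\mathbb Z$ with Lebesgue measure, let all function spaces be complex valued, and let $\langle f,g\rangle=\int_{\mathbb T} f\bar g\,dy$. For $\nu>0$ and $\beta\in\mathbb R$ let $$L_1u=\nu u''-\nu u-\frac{i\beta}{\nu}\sin y\,u,\qquad D(L_1)=H^2(\mathbb T)\subset L^2(\mathbb T).$$ For $\nu>0$, $\gamma\in\mathbb R$, $k_f>0$ and $k_1,k_3\in\mathbb Z$, $(k_1,k_3)\neq(0,0)$, let $$\mathcal L'_{k_1,k_3}f=-\nu k_f^2f''+\frac{ik_1}{k_f^2}\frac{\gamma}{\nu}\sin y\,\Big(1-\Big(\tfrac{k_1^2+k_3^2}{k_f^2}-\partial_y^2\Big)^{-1}\Big)f,\qquad D(\mathcal L'_{k_1,k_3})=H^2(\mathbb T).$$ Let $X=\{f\in L^2(\mathbb T):\int_{\mathbb T}f\,dy=0\}$ with the norm $\|f\|_*=\langle f,f-(1-\partial_y^2)^{-1}f\rangle^{1/2}$, let $\mathbb Q_1$ be the orthogonal projection of $L^2(\mathbb T)$ onto $X$, regard $\mathbb Q_1\mathcal L'_{k_1,k_3}$ as an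 operator in $X$ with domain $H^2(\mathbb T)\cap X$, and let $$\Psi(\mathbb Q_1\mathcal L'_{k_1,k_3})=\inf\big\{\|(\mathbb Q_1\mathcal L'_{k_1,k_3}-i\lambda)f\|_*:\ f\in H^2(\mathbb T)\cap X,\ \lambda\in\mathbb R,\ \|f\|_*=1\big\}.$$ There are absolute constants $C,c>0$ such that the following holds. 1. For all $\nu>0$ and $\beta\in\mathbb R\setminus\{0\}$ the operator $L_1:H^2(\mathbb T)\to L^2(\mathbb T)$ is invertible, with an inverse that is bounded on $L^2(\mathbb T)$, and for all $f\in L^2(\mathbb T)$ $$\|L_1^{-1}f\|_{L^2}\le C|\beta|^{-2/3}\nu^{1/3}\|f\|_{L^2},\qquad \|L_1^{-1}f\|_{L^1}\le C|\beta|^{-5/6}\nu^{2/3}\|f\|_{L^2}.$$ 2. If moreover $\nu^2\le|\beta|$, then $|\langle L_1^{-1}1,1\rangle|\ge c\,\nu/|\beta|$. 3. For all $\nu>0$, $\gamma\in\mathbb R$, $k_f>0$ and $k_1,k_3\in\mathbb Z$ with $k_1^2+k_3^2=k_f^2=1$, $$\Psi(\mathbb Q_1\mathcal L'_{k_1,k_3})\ge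 c\,|k_1\gamma|^{1/2}.$$ -/

import Mathlib

open MeasureTheory
open scoped ContDiff

noncomputable section

namespace KolmogorovFlow

instance factTwoPiPos : Fact (0 < 2 * Real.pi) := ⟨Real.two_pi_pos⟩

/-- The torus of length `2π`, with Lebesgue measure of total mass `2π`. -/
abbrev Torus : Type := AddCircle (2 * Real.pi)

/-- Complex valued square integrable functions on the torus. -/
abbrev L2T : Type := Lp ℂ 2 (volume : Measure Torus)

/-- Smooth `2π`-periodic test functions. -/
def IsTestFunction (φ : ℝ → ℂ) : Prop :=
  ContDiff ℝ ∞ φ ∧ Function.Periodic φ (2 * Real.pi)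

/-- `g` is the weak derivative of `f` on the torus. -/
def IsWeakDeriv (f g : L2T) : Prop :=
  ∀ φ : ℝ → ℂ, IsTestFunction φ →
    ∫ y in (0 : ℝ)..(2 * Real.pi), f (y : Torus) * deriv φ y =
      -∫ y in (0 : ℝ)..(2 * Real.pi), g (y : Torus) * φ y

/-! ### Helper facts: weak derivatives in terms of Fourier coefficients -/

/-- Pairing with a continuous periodic function is a continuous linear functional. -/
theorem exists_pairing (φ : ℝ → ℂ) (hc : Continuous φ) (hp : Function.Periodic φ (2 * Real.pi)) :
    ∃ Φ : L2T, ∀ f : L2T,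
      ∫ y in (0 : ℝ)..(2 * Real.pi), f (y : Torus) * φ y = inner ℂ Φ f := by
  have hcl : Continuous (hp.lift : Torus → ℂ) := continuous_coinduced_dom.mpr hc
  let ψ : C(Torus, ℂ) := ⟨fun x => star (hp.lift x), hcl.star⟩
  refine ⟨ContinuousMap.toLp 2 volume ℂ ψ, fun f => ?_⟩
  rw [L2.inner_def]
  have h1 : ∫ a : Torus, inner ℂ ((ContinuousMap.toLp 2 volume ℂ ψ : L2T) a) (f a) =
      ∫ a : Torus, f a * hp.lift a := by
    refine integral_congr_ae ?_
    filter_upwards [ContinuousMap.coeFn_toLp (p := 2) (𝕜 := ℂ) volume ψ] with a ha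
    rw [ha]
    simp [ψ]
  rw [h1, ← AddCircle.intervalIntegral_preimage (2 * Real.pi) 0]
  simp

/-- The exponential `e^{iny}` as an element of `L²`. -/
def expL2 (n : ℤ) : L2T := ContinuousMap.toLp 2 volume ℂ (fourier n)

theorem inner_expL2 (n : ℤ) (f : L2T) :
    inner ℂ (expL2 n) f = ((2 * Real.pi : ℝ) : ℂ) * fourierCoeff (f : Torus → ℂ) n := by
  rw [L2.inner_def]
  have h1 : ∫ a : Torus, inner ℂ (expL2 n a) (f a) = ∫ a : Torus, fourier (-n) a • f a := by
    refine integral_congr_ae ?_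
    filter_upwards [ContinuousMap.coeFn_toLp (p := 2) (𝕜 := ℂ) volume (fourier n)] with a ha
    rw [expL2, ha]
    simp [mul_comm]
  rw [h1, fourierCoeff, AddCircle.integral_haarAddCircle, Complex.real_smul, ← mul_assoc,
    ← Complex.ofReal_mul, mul_inv_cancel₀ Real.two_pi_pos.ne']
  simp

theorem eq_zero_of_inner_expL2 (f : L2T) (h : ∀ n, inner ℂ (expL2 n) f = 0) : f = 0 := by
  have hm : MemLp (f : Torus → ℂ) 2 AddCircle.haarAddCircle := (Lp.memLp f).haarAddCircle
  have h0 : hm.toLp f = 0 := by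
    apply fourierBasis.repr.injective
    ext n
    rw [fourierBasis_repr, fourierCoeff_congr_ae hm.coeFn_toLp]
    have := h n
    rw [inner_expL2] at this
    have h2 : ((2 * Real.pi : ℝ) : ℂ) ≠ 0 := Complex.ofReal_ne_zero.mpr Real.two_pi_pos.ne'
    simpa [h2] using this
  have h1 : (f : Torus → ℂ) =ᵐ[AddCircle.haarAddCircle] 0 :=
    hm.coeFn_toLp.symm.trans (by rw [h0]; exact Lp.coeFn_zero _ _ _)
  apply Lp.ext
  refine Filter.EventuallyEq.trans ?_ (Lp.coeFn_zero _ _ _).symm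
  have h2 : ∀ᵐ x ∂(ENNReal.ofReal (2 * Real.pi) • (AddCircle.haarAddCircle : Measure Torus)),
      (f : Torus → ℂ) x = 0 := Measure.ae_smul_measure h1 _
  exact h2

theorem inner_expL2_expL2 (m n : ℤ) :
    inner ℂ (expL2 m) (expL2 n) = if m = n then ((2 * Real.pi : ℝ) : ℂ) else 0 := by
  rw [inner_expL2]
  have h1 : (expL2 n : Torus → ℂ) =ᵐ[AddCircle.haarAddCircle] (fourier n : C(Torus, ℂ)) := by
    have h := ContinuousMap.coeFn_toLp (p := 2) (𝕜 := ℂ) (volume : Measure Torus) (fourier n)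
    have h2 : ∀ᵐ x ∂(ENNReal.ofReal (2 * Real.pi) • (AddCircle.haarAddCircle : Measure Torus)),
        expL2 n x = (fourier n : C(Torus, ℂ)) x := h
    exact (Measure.ae_ennreal_smul_measure_iff (by simp [Real.pi_pos])).mp h2
  rw [fourierCoeff_congr_ae h1, fourierCoeff_fourier]
  by_cases hmn : m = n <;> simp [hmn]

/-- The normalised exponentials form a Hilbert basis of `L²`. -/
def expBasis : HilbertBasis ℤ ℂ L2T :=
  HilbertBasis.mkOfOrthogonalEqBot
    (v := fun n => (((Real.sqrt (2 * Real.pi))⁻¹ : ℝ) : ℂ) • expL2 n)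
    (by
      rw [orthonormal_iff_ite]
      intro m n
      have h : (Real.sqrt (2 * Real.pi))⁻¹ * ((Real.sqrt (2 * Real.pi))⁻¹ * (2 * Real.pi)) = 1 := by
        have h2 := Real.mul_self_sqrt Real.two_pi_pos.le
        have h3 : Real.sqrt (2 * Real.pi) ≠ 0 := (Real.sqrt_pos.mpr Real.two_pi_pos).ne'
        field_simp
        nlinarith
      rw [inner_smul_left, inner_smul_right, inner_expL2_expL2]
      split_ifs
      · rw [Complex.conj_ofReal]
        exact_mod_cast h
      · simp)
    (by
      rw [Submodule.eq_bot_iff]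
      intro f hf
      refine eq_zero_of_inner_expL2 f fun n => ?_
      have h := (Submodule.mem_orthogonal _ _).mp hf _ (Submodule.subset_span ⟨n, rfl⟩)
      simp only [inner_smul_left] at h
      refine (mul_eq_zero.mp h).resolve_left ?_
      simp [Real.sqrt_eq_zero', Real.pi_pos])

theorem expBasis_apply (n : ℤ) :
    expBasis n = (((Real.sqrt (2 * Real.pi))⁻¹ : ℝ) : ℂ) • expL2 n := by
  simp [expBasis]

theorem inner_expBasis (n : ℤ) (f : L2T) :
    inner ℂ (expBasis n) f = (((Real.sqrt (2 * Real.pi))⁻¹ : ℝ) : ℂ) * inner ℂ (expL2 n) f := by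
  rw [expBasis_apply, inner_smul_left, Complex.conj_ofReal]

theorem hasDerivAt_exp (n : ℤ) (x : ℝ) :
    HasDerivAt (fun y : ℝ => fourier n (y : Torus))
      (Complex.I * n * fourier n (x : Torus)) x := by
  have h := hasDerivAt_fourier (2 * Real.pi) n x
  convert h using 2
  have : (Real.pi : ℂ) ≠ 0 := Complex.ofReal_ne_zero.mpr Real.pi_pos.ne'
  push_cast
  field_simp

theorem isTestFunction_exp (n : ℤ) :
    IsTestFunction (fun y : ℝ => (fourier n (y : Torus) : ℂ)) := by
  refine ⟨?_, fun y => ?_⟩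
  · simp_rw [fourier_coe_apply]
    have h : ContDiff ℝ ∞ fun y : ℝ => (y : ℂ) := Complex.ofRealCLM.contDiff
    exact ((contDiff_const.mul h).div_const _).cexp
  · have : ((y + 2 * Real.pi : ℝ) : Torus) = (y : Torus) := by
      rw [AddCircle.coe_add, AddCircle.coe_period, add_zero]
    simp only [this]

theorem integral_expL2 (n : ℤ) (φ : ℝ → ℂ)
    (hp : Function.Periodic φ (2 * Real.pi)) :
    ∫ y in (0 : ℝ)..(2 * Real.pi), expL2 n (y : Torus) * φ y =
      ∫ y in (0 : ℝ)..(2 * Real.pi), fourier n (y : Torus) * φ y := by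
  have key : ∀ F : Torus → ℂ, ∫ y in (0 : ℝ)..(2 * Real.pi), F (y : Torus) * φ y =
      ∫ a : Torus, F a * hp.lift a := by
    intro F
    rw [← AddCircle.intervalIntegral_preimage (2 * Real.pi) 0]
    simp
  rw [key, key]
  refine integral_congr_ae ?_
  filter_upwards [ContinuousMap.coeFn_toLp (p := 2) (𝕜 := ℂ) volume (fourier n)] with a ha
  rw [expL2, ha]

theorem integral_exp_mul (n : ℤ) (f : L2T) :
    ∫ y in (0 : ℝ)..(2 * Real.pi), f (y : Torus) * fourier (-n) (y : Torus) =
      inner ℂ (expL2 n) f := by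
  rw [inner_expL2, fourierCoeff_eq_intervalIntegral _ _ 0]
  rw [Complex.real_smul, ← mul_assoc, ← Complex.ofReal_mul,
    mul_one_div_cancel Real.two_pi_pos.ne']
  simp [mul_comm]

/-- Weak differentiation multiplies the `n`-th Fourier coefficient by `in`. -/
theorem isWeakDeriv_iff (f g : L2T) :
    IsWeakDeriv f g ↔ ∀ n : ℤ, inner ℂ (expL2 n) g = Complex.I * n * inner ℂ (expL2 n) f := by
  constructor
  · intro h n
    have h1 := h _ (isTestFunction_exp (-n))
    have h2 : ∀ y : ℝ, deriv (fun y : ℝ => (fourier (-n) (y : Torus) : ℂ)) y =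
        (-(Complex.I * n)) * fourier (-n) (y : Torus) := fun y => by
      rw [(hasDerivAt_exp (-n) y).deriv]
      push_cast
      ring
    simp only [h2, mul_left_comm _ (-(Complex.I * (n : ℂ)))] at h1
    rw [intervalIntegral.integral_const_mul, integral_exp_mul, integral_exp_mul] at h1
    linear_combination h1
  · intro h φ hφ
    have hd : Continuous (deriv φ) := hφ.1.continuous_deriv (by simp)
    have hdp : Function.Periodic (deriv φ) (2 * Real.pi) := fun y => by
      have : (fun x => φ (x + 2 * Real.pi)) = φ := funext hφ.2
      rw [← deriv_comp_add_const, this]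
    obtain ⟨Φ, hΦ⟩ := exists_pairing φ hφ.1.continuous hφ.2
    obtain ⟨Ψ, hΨ⟩ := exists_pairing (deriv φ) hd hdp
    rw [hΦ, hΨ]
    have key : ∀ n : ℤ, inner ℂ Ψ (expL2 n) = -(Complex.I * n) * inner ℂ Φ (expL2 n) := by
      intro n
      rw [← hΦ, ← hΨ, integral_expL2 n _ hdp, integral_expL2 n _ hφ.2]
      rw [intervalIntegral.integral_mul_deriv_eq_deriv_mul
        (u' := fun x : ℝ => Complex.I * n * fourier n (x : Torus))
        (fun x _ => hasDerivAt_exp n x)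
        (fun x _ => ((hφ.1.differentiable (by simp)) x).hasDerivAt)
        (Continuous.intervalIntegrable (by
          have := (isTestFunction_exp n).1.continuous
          fun_prop) _ _)
        (hd.intervalIntegrable _ _)]
      have e1 : φ (2 * Real.pi) = φ 0 := by simpa using hφ.2 0
      simp only [mul_assoc, intervalIntegral.integral_const_mul]
      have e2 : ((2 * Real.pi : ℝ) : Torus) = ((0 : ℝ) : Torus) := by
        rw [AddCircle.coe_period, AddCircle.coe_zero]
      rw [e1, e2]
      ring
    rw [← (expBasis.hasSum_inner_mul_inner Ψ f).tsum_eq,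
      ← (expBasis.hasSum_inner_mul_inner Φ g).tsum_eq, ← tsum_neg]
    refine tsum_congr fun n => ?_
    rw [inner_expBasis, inner_expBasis, expBasis_apply, inner_smul_right, inner_smul_right,
      key, h]
    ring

/-- The pairs `(f, f'')` with `f` twice weakly differentiable in `L²`. -/
def secondDerivGraph : Submodule ℂ (L2T × L2T) where
  carrier := {p | ∃ g : L2T, IsWeakDeriv p.1 g ∧ IsWeakDeriv g p.2}
  add_mem' := by
    rintro p q ⟨g, h1, h2⟩ ⟨k, h3, h4⟩
    refine ⟨g + k, ?_, ?_⟩ <;> rw [isWeakDeriv_iff] at * <;> intro n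
    · rw [Prod.fst_add, inner_add_right, inner_add_right, h1, h3]; ring
    · rw [Prod.snd_add, inner_add_right, inner_add_right, h2, h4]; ring
  zero_mem' := by
    refine ⟨0, ?_, ?_⟩ <;> rw [isWeakDeriv_iff] <;> intro n <;> simp
  smul_mem' := by
    rintro c p ⟨g, h1, h2⟩
    refine ⟨c • g, ?_, ?_⟩ <;> rw [isWeakDeriv_iff] at * <;> intro n
    · rw [Prod.smul_fst, inner_smul_right, inner_smul_right, h1]; ring
    · rw [Prod.smul_snd, inner_smul_right, inner_smul_right, h2]; ring

theorem inner_of_mem_secondDerivGraph {p : L2T × L2T} (hp : p ∈ secondDerivGraph) (n : ℤ) :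
    inner ℂ (expL2 n) p.2 = -(n : ℂ) ^ 2 * inner ℂ (expL2 n) p.1 := by
  obtain ⟨g, h1, h2⟩ := hp
  rw [isWeakDeriv_iff] at h1 h2
  rw [h2, h1]
  linear_combination (n : ℂ) ^ 2 * inner ℂ (expL2 n) p.1 * Complex.I_sq

/-- The second weak derivative is unique. -/
theorem secondDerivGraph_single_valued (p : L2T × L2T) (hp : p ∈ secondDerivGraph)
    (h0 : p.1 = 0) : p.2 = 0 := by
  refine eq_zero_of_inner_expL2 _ fun n => ?_
  rw [inner_of_mem_secondDerivGraph hp, h0]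
  simp

/-- The operator `f ↦ f''` on `L²`, with domain the Sobolev space `H²`. -/
def D2 : L2T →ₗ.[ℂ] L2T := secondDerivGraph.toLinearPMap

/-- The Sobolev space `H²` of the torus. -/
def H2 : Submodule ℂ L2T := D2.domain

/-- The map `u ↦ u''` on `H²`. -/
def secondDeriv : H2 →ₗ[ℂ] L2T := D2.toFun

theorem D2_graph : D2.graph = secondDerivGraph :=
  Submodule.toLinearPMap_graph_eq _ secondDerivGraph_single_valued

theorem mem_H2_iff (f : L2T) :
    f ∈ H2 ↔ ∃ g h : L2T, IsWeakDeriv f g ∧ IsWeakDeriv g h := by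
  rw [H2, LinearPMap.mem_domain_iff, D2_graph]
  exact exists_comm

theorem inner_expL2_secondDeriv (u : H2) (n : ℤ) :
    inner ℂ (expL2 n) (secondDeriv u) = -(n : ℂ) ^ 2 * inner ℂ (expL2 n) (u : L2T) := by
  have h := LinearPMap.mem_graph D2 u
  rw [D2_graph] at h
  exact inner_of_mem_secondDerivGraph h n

theorem secondDeriv_eq_iff (u : H2) (h : L2T) :
    secondDeriv u = h ↔ ∃ g : L2T, IsWeakDeriv (u : L2T) g ∧ IsWeakDeriv g h := by
  have hu := LinearPMap.mem_graph D2 u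
  rw [D2_graph] at hu
  constructor
  · rintro rfl
    exact hu
  · intro hg
    rw [← sub_eq_zero]
    exact secondDerivGraph_single_valued _
      (secondDerivGraph.sub_mem hu (show ((u : L2T), h) ∈ secondDerivGraph from hg)) (sub_self _)

/-- The map `u ↦ s u - u''` from `H²` to `L²`. -/
def helmholtz (s : ℝ) : H2 →ₗ[ℂ] L2T := (s : ℂ) • H2.subtype - secondDeriv

theorem inner_expL2_helmholtz (s : ℝ) (u : H2) (n : ℤ) :
    inner ℂ (expL2 n) (helmholtz s u) =
      ((s + (n : ℝ) ^ 2 : ℝ) : ℂ) * inner ℂ (expL2 n) (u : L2T) := by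
  have h : helmholtz s u = (s : ℂ) • (u : L2T) - secondDeriv u := rfl
  rw [h, inner_sub_right, inner_smul_right, inner_expL2_secondDeriv]
  push_cast
  ring

theorem exists_multiplier (m : ℤ → ℂ) (C : ℝ) (hm : ∀ n, ‖m n‖ ≤ C) (f : L2T) :
    ∃ u : L2T, ∀ n, inner ℂ (expL2 n) u = m n * inner ℂ (expL2 n) f := by
  have hmem : Memℓp (fun n => m n * expBasis.repr f n) 2 := by
    rw [memℓp_gen_iff (by norm_num)]
    have h1 := (memℓp_gen_iff (by norm_num)).mp (lp.memℓp (expBasis.repr f))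
    refine Summable.of_nonneg_of_le (fun n => by positivity) (fun n => ?_) (h1.mul_left (C ^ 2))
    have h2 : (2 : ENNReal).toReal = ((2 : ℕ) : ℝ) := by norm_num
    rw [h2, Real.rpow_natCast, Real.rpow_natCast, norm_mul, mul_pow]
    have := hm n
    gcongr
  refine ⟨expBasis.repr.symm ⟨_, hmem⟩, fun n => ?_⟩
  have h1 := expBasis.repr_apply_apply (expBasis.repr.symm ⟨_, hmem⟩) n
  rw [LinearIsometryEquiv.apply_symm_apply] at h1
  change m n * expBasis.repr f n = _ at h1
  rw [expBasis.repr_apply_apply, inner_expBasis, inner_expBasis] at h1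
  have h3 : (((Real.sqrt (2 * Real.pi))⁻¹ : ℝ) : ℂ) ≠ 0 :=
    Complex.ofReal_ne_zero.mpr (inv_ne_zero (Real.sqrt_pos.mpr Real.two_pi_pos).ne')
  apply mul_left_cancel₀ h3
  rw [← h1]
  ring

theorem helmholtz_bijective {s : ℝ} (hs : 0 < s) : Function.Bijective (helmholtz s) := by
  have hpos : ∀ n : ℤ, 0 < s + (n : ℝ) ^ 2 := fun n => by positivity
  have hne : ∀ n : ℤ, ((s + (n : ℝ) ^ 2 : ℝ) : ℂ) ≠ 0 := fun n =>
    Complex.ofReal_ne_zero.mpr (hpos n).ne'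
  constructor
  · rw [injective_iff_map_eq_zero]
    intro u hu
    refine Subtype.ext (eq_zero_of_inner_expL2 _ fun n => ?_)
    have h := inner_expL2_helmholtz s u n
    rw [hu, inner_zero_right] at h
    exact (mul_eq_zero.mp h.symm).resolve_left (hne n)
  · intro f
    obtain ⟨u, hu⟩ := exists_multiplier (fun n => ((s + (n : ℝ) ^ 2 : ℝ) : ℂ)⁻¹) s⁻¹ (fun n => by
      rw [norm_inv, Complex.norm_real, Real.norm_of_nonneg (hpos n).le]
      gcongr
      nlinarith [sq_nonneg (n : ℝ)]) f
    obtain ⟨w, hw⟩ := exists_multiplier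
      (fun n => Complex.I * n * ((s + (n : ℝ) ^ 2 : ℝ) : ℂ)⁻¹) (1 + s⁻¹) (fun n => by
      rw [norm_mul, norm_mul, norm_inv, Complex.norm_real, Real.norm_of_nonneg (hpos n).le,
        Complex.norm_I, one_mul, Complex.norm_intCast, ← div_eq_mul_inv, div_le_iff₀ (hpos n)]
      have h1 : s⁻¹ * s = 1 := inv_mul_cancel₀ hs.ne'
      have h2 : (1 + s⁻¹) * (s + (n : ℝ) ^ 2) = s + |(n : ℝ)| ^ 2 + 1 + s⁻¹ * |(n : ℝ)| ^ 2 := by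
        rw [sq_abs]
        linear_combination h1
      have h3 : 0 ≤ s⁻¹ * |(n : ℝ)| ^ 2 := by positivity
      rw [h2]
      nlinarith [sq_nonneg (|(n : ℝ)| - 1)]) f
    obtain ⟨v, hv⟩ : ∃ v : L2T, v = (s : ℂ) • u - f := ⟨_, rfl⟩
    have huw : IsWeakDeriv u w := by
      rw [isWeakDeriv_iff]
      intro n
      rw [hw, hu]
      ring
    have hwv : IsWeakDeriv w v := by
      rw [isWeakDeriv_iff]
      intro n
      rw [hw, hv, inner_sub_right, inner_smul_right, hu]
      have h1 := mul_inv_cancel₀ (hne n)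
      have h2 : ((s + (n : ℝ) ^ 2 : ℝ) : ℂ) = (s : ℂ) + (n : ℂ) ^ 2 := by push_cast; ring
      linear_combination inner ℂ (expL2 n) f * h1 -
        inner ℂ (expL2 n) f * ((s + (n : ℝ) ^ 2 : ℝ) : ℂ)⁻¹ * h2 -
        inner ℂ (expL2 n) f * ((s + (n : ℝ) ^ 2 : ℝ) : ℂ)⁻¹ * (n : ℂ) ^ 2 * Complex.I_sq
    have hmem : u ∈ H2 := (mem_H2_iff u).mpr ⟨w, v, huw, hwv⟩
    refine ⟨⟨u, hmem⟩, ?_⟩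
    rw [← sub_eq_zero]
    refine eq_zero_of_inner_expL2 _ fun n => ?_
    rw [inner_sub_right, inner_expL2_helmholtz, hu, mul_inv_cancel_left₀ (hne n), sub_self]

/-! ### The operators -/

/-- The operator `(s - ∂²)⁻¹` on `L²`, for `s > 0` (it is only used there). -/
def helmholtzInv (s : ℝ) : L2T →ₗ[ℂ] L2T :=
  if hs : 0 < s then
    H2.subtype ∘ₗ
      ((LinearEquiv.ofBijective (helmholtz s) (helmholtz_bijective hs)).symm : L2T →ₗ[ℂ] H2)
  else 0

theorem helmholtzInv_eq_iff {s : ℝ} (hs : 0 < s) (f : L2T) (u : H2) :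
    helmholtzInv s f = u ↔ (s : ℂ) • (u : L2T) - secondDeriv u = f := by
  have h : helmholtzInv s f =
      (((LinearEquiv.ofBijective (helmholtz s) (helmholtz_bijective hs)).symm f : H2) : L2T) := by
    rw [helmholtzInv, dif_pos hs]
    rfl
  rw [h, Subtype.coe_inj, LinearEquiv.symm_apply_eq, eq_comm]
  rfl

/-- The sine function on the torus. -/
def sinT : Torus → ℝ := Real.sin_periodic.lift

theorem continuous_sinT : Continuous sinT := continuous_coinduced_dom.mpr Real.continuous_sin

theorem norm_sinT_le (x : Torus) : ‖(sinT x : ℂ)‖ ≤ 1 := by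
  induction x using QuotientAddGroup.induction_on with
  | H y =>
    rw [Complex.norm_real]
    exact Real.abs_sin_le_one y

theorem memLp_sin_mul (f : L2T) :
    MemLp (fun x : Torus => (sinT x : ℂ) * f x) 2 volume := by
  have h : Continuous fun x : Torus => (sinT x : ℂ) :=
    Complex.continuous_ofReal.comp continuous_sinT
  refine (Lp.memLp f).of_le (h.aestronglyMeasurable.mul (Lp.aestronglyMeasurable f)) ?_
  refine Filter.Eventually.of_forall fun x => ?_
  rw [norm_mul]
  exact mul_le_of_le_one_left (norm_nonneg _) (norm_sinT_le x)

/-- Multiplication by `sin y` on `L²`. -/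
def mulSin : L2T →ₗ[ℂ] L2T where
  toFun f := (memLp_sin_mul f).toLp _
  map_add' f g := by
    rw [← MemLp.toLp_add, MemLp.toLp_eq_toLp_iff]
    filter_upwards [Lp.coeFn_add f g] with x hx
    rw [hx]
    exact mul_add _ _ _
  map_smul' c f := by
    rw [RingHom.id_apply, ← MemLp.toLp_const_smul, MemLp.toLp_eq_toLp_iff]
    filter_upwards [Lp.coeFn_smul c f] with x hx
    rw [hx]
    exact mul_left_comm _ _ _

/-- The constant function `1`. -/
def one : L2T := Lp.const 2 volume (1 : ℂ)

/-- `L₁ u = ν u'' - ν u - i (β/ν) sin y u`, with domain `H²`. -/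
def opL1 (ν β : ℝ) : L2T →ₗ.[ℂ] L2T where
  domain := H2
  toFun := (ν : ℂ) • secondDeriv - (ν : ℂ) • H2.subtype
    - (Complex.I * (β / ν : ℝ)) • (mulSin ∘ₗ H2.subtype)

/-- `L' = -ν k_f² ∂² + (i k₁ / k_f²) (γ/ν) sin y (1 - (b² - ∂²)⁻¹)` with
`b² = (k₁² + k₃²) / k_f²`, with domain `H²`. -/
def opL' (ν γ kf : ℝ) (k₁ k₃ : ℤ) : L2T →ₗ.[ℂ] L2T where
  domain := H2
  toFun := -((ν * kf ^ 2 : ℝ) : ℂ) • secondDeriv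
    + (Complex.I * (k₁ / kf ^ 2 * (γ / ν) : ℝ)) •
      (mulSin ∘ₗ (LinearMap.id - helmholtzInv (((k₁ : ℝ) ^ 2 + (k₃ : ℝ) ^ 2) / kf ^ 2)) ∘ₗ
        H2.subtype)

/-- The space `X = L²₀` of square integrable functions with mean zero. -/
def meanZero : Submodule ℂ L2T where
  carrier := {f | ∫ y : Torus, f y = 0}
  add_mem' := by
    intro f g hf hg
    have hi : ∀ f : L2T, Integrable (f : Torus → ℂ) := fun f =>
      (Lp.memLp f).integrable (by norm_num)
    change ∫ y : Torus, (f + g : L2T) y = 0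
    rw [integral_congr_ae (Lp.coeFn_add f g)]
    simp only [Pi.add_apply]
    rw [integral_add (hi f) (hi g)]
    rw [Set.mem_ofPred_eq] at hf hg
    rw [hf, hg, add_zero]
  zero_mem' := by
    change ∫ y : Torus, (0 : L2T) y = 0
    rw [integral_congr_ae (Lp.coeFn_zero _ _ _)]
    simp
  smul_mem' := by
    intro c f hf
    change ∫ y : Torus, (c • f : L2T) y = 0
    rw [integral_congr_ae (Lp.coeFn_smul c f)]
    simp only [Pi.smul_apply]
    rw [integral_smul]
    rw [Set.mem_ofPred_eq] at hf
    rw [hf, smul_zero]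

theorem meanZero_eq : meanZero = (Submodule.span ℂ {one})ᗮ := by
  ext f
  rw [Submodule.mem_orthogonal_singleton_iff_inner_right, L2.inner_def]
  have h : ∫ y : Torus, inner ℂ (one y) (f y) = ∫ y : Torus, f y := by
    refine integral_congr_ae ?_
    filter_upwards [Lp.coeFn_const 2 (volume : Measure Torus) (1 : ℂ)] with y hy
    rw [one, hy]
    simp
  rw [h]
  rfl

instance hasOrthogonalProjection_meanZero : meanZero.HasOrthogonalProjection := by
  rw [meanZero_eq]
  infer_instance

/-- The orthogonal projection `Q₁` of `L²` onto `X`. -/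
def Q1 : L2T →ₗ[ℂ] meanZero := (meanZero.orthogonalProjectionOnto : L2T →L[ℂ] meanZero)

/-- The operator `Q₁ L'` in `X`, with domain `H² ∩ X`. -/
def opQ1L' (ν γ kf : ℝ) (k₁ k₃ : ℤ) : meanZero →ₗ.[ℂ] meanZero where
  domain := H2.comap meanZero.subtype
  toFun := Q1 ∘ₗ (opL' ν γ kf k₁ k₃).toFun ∘ₗ
    (meanZero.subtype.restrict (p := H2.comap meanZero.subtype) (q := H2) fun _ hf => hf)

/-- The norm `‖f‖_* = ⟨f, f - (1 - ∂²)⁻¹ f⟩^{1/2}` on `X`. -/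
def starNorm (f : meanZero) : ℝ :=
  Real.sqrt (inner ℂ (f : L2T) ((f : L2T) - helmholtzInv 1 (f : L2T))).re

/-- `Ψ(H) = inf {‖(H - iμ) f‖ ; f ∈ D(H), μ ∈ ℝ, ‖f‖ = 1}`, for the norm `N`. -/
def pseudospectralBound {E : Type*} [AddCommGroup E] [Module ℂ E] (N : E → ℝ)
    (H : E →ₗ.[ℂ] E) : ℝ :=
  sInf {r : ℝ | ∃ (f : H.domain) (μ : ℝ),
    N (f : E) = 1 ∧ r = N (H f - (Complex.I * (μ : ℂ)) • (f : E))}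

/-- The bounded operator `T` is the inverse of the (unbounded) operator `H`. -/
def IsBoundedInverse {E : Type*} [NormedAddCommGroup E] [NormedSpace ℂ E] (H : E →ₗ.[ℂ] E)
    (T : E →L[ℂ] E) : Prop :=
  (∀ u : H.domain, T (H u) = u) ∧ ∀ f : E, ∃ h : T f ∈ H.domain, H ⟨T f, h⟩ = f

end KolmogorovFlow

end

/-! Both parts concern a shear equation `-g'' + κ g + iβ (S - μ) g = y`, in which the symmetric
operator `S` and a companion `C` satisfy the derivative and Pythagoras relations of the sine and the
cosine. For `L₁` these are the multiplications by `sin` and `cos`. For `ℚ₁ℒ'` conjugation by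
`K^{1/2} = (1 - (1 - ∂²)⁻¹)^{1/2}` turns `‖·‖_*` into the `L²` norm and `sin` into
`K^{1/2} sin K^{1/2}`; this no longer commutes with its companion, and `S² + C²` is only bounded
above by `1`, but the derivative of `[C, S]` is nonnegative and makes up for the loss in `S² + C²`.

Testing the equation with `g`, `(S - μ) g` and `g''` bounds `‖g'‖`, `‖(S - μ) g‖` and `‖g''‖`, while
the commutator of the derivative with `S` controls `‖C g‖` by `‖(S - μ) g‖`: a function on which
`S - μ` is small either lives near a critical point of the sine or oscillates. Together these
inequalities bound `‖g‖` by `‖y‖` with the power of `β` dictated by scaling.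

The `L¹` bound follows from the Cauchy–Schwarz inequality with the weight `δ² + sin²`, where `δ` is
the width of the layer around the zeros of the sine. For the lower bound, `Re ⟨u, 1⟩` equals the
energy of `u`, which is bounded below by testing the equation with a bump of width `δ`. -/

noncomputable section

namespace KolmogorovFlow

/-! ### Sine–cosine pairs and the commutator method -/

section InnerProduct

variable {E : Type*} [NormedAddCommGroup E] [InnerProductSpace ℂ E]

theorem abs_re_inner_le (x y : E) : |(inner ℂ x y).re| ≤ ‖x‖ * ‖y‖ :=
  (Complex.abs_re_le_norm _).trans (norm_inner_le_norm x y)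

theorem abs_im_inner_le (x y : E) : |(inner ℂ x y).im| ≤ ‖x‖ * ‖y‖ :=
  (Complex.abs_im_le_norm _).trans (norm_inner_le_norm x y)

theorem re_inner_comm (x y : E) : (inner ℂ x y).re = (inner ℂ y x).re :=
  inner_re_symm (𝕜 := ℂ) x y

theorem im_inner_comm (x y : E) : (inner ℂ x y).im = -(inner ℂ y x).im :=
  inner_im_symm (𝕜 := ℂ) x y

theorem re_inner_self (x : E) : (inner ℂ x x).re = ‖x‖ ^ 2 :=
  (norm_sq_eq_re_inner (𝕜 := ℂ) x).symm

theorem im_inner_apply_self {S : E →ₗ[ℂ] E} (hS : S.IsSymmetric) (x : E) :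
    (inner ℂ (S x) x).im = 0 :=
  hS.im_inner_apply_self x

end InnerProduct

theorem im_ofReal_sq (r : ℝ) : ((r : ℂ) ^ 2).im = 0 := by
  norm_cast

theorem exists_nonneg_pow_eq {n : ℕ} (hn : n ≠ 0) {x : ℝ} (hx : 0 ≤ x) :
    ∃ r : ℝ, 0 ≤ r ∧ r ^ n = x :=
  ⟨x ^ (n⁻¹ : ℝ), Real.rpow_nonneg hx _, Real.rpow_inv_natCast_pow hx hn⟩

theorem le_two_mul_of_sq_le {a b t : ℝ} (hab : a ≤ b) (hb : 0 ≤ b)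
    (h : t ^ 2 ≤ a * t + b ^ 2) : t ≤ 2 * b := by
  by_contra! hlt
  nlinarith

/-- Bounded symmetric operators `S`, `C` that behave like the multiplications by `sin` and `cos`
with respect to a skew-symmetric derivation. The derivation is given by its graph `D`, and `P` is
the derivative of the commutator `[C, S]`; for the genuine sine and cosine `P = 0`. -/
structure IsSinCosPair {E : Type*} [NormedAddCommGroup E] [InnerProductSpace ℂ E]
    (D : Submodule ℂ (E × E)) (S C P : E →ₗ[ℂ] E) : Prop where
  inner_deriv : ∀ {x x' y y' : E}, (x, x') ∈ D → (y, y') ∈ D → inner ℂ x' y = -inner ℂ x y'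
  deriv_sin : ∀ {x x' : E}, (x, x') ∈ D → (S x, S x' + C x) ∈ D
  deriv_cos : ∀ {x x' : E}, (x, x') ∈ D → (C x, C x' - S x) ∈ D
  sin_symm : S.IsSymmetric
  cos_symm : C.IsSymmetric
  deriv_comm : ∀ x, (C (S x) - S (C x), P x) ∈ D
  comm_nonneg : ∀ x, 0 ≤ (inner ℂ (P x) x).re
  sq_add_sq_le : ∀ x, ‖S x‖ ^ 2 + ‖C x‖ ^ 2 ≤ ‖x‖ ^ 2

/-- `g` solves the stationary shear equation `-g'' + κ g + iβ (S - μ) g = y`, where `g₁ = g'` and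
`g₂ = g''` for the derivation with graph `D`. -/
structure IsShearSolution {E : Type*} [NormedAddCommGroup E] [InnerProductSpace ℂ E]
    (D : Submodule ℂ (E × E)) (S : E →ₗ[ℂ] E) (κ β μ : ℝ) (g g₁ g₂ y : E) : Prop where
  deriv : (g, g₁) ∈ D
  deriv_deriv : (g₁, g₂) ∈ D
  eq : y = -g₂ + (κ : ℂ) • g + (Complex.I * β) • (S g - (μ : ℂ) • g)

section Commutator

variable {E : Type*} [NormedAddCommGroup E] [InnerProductSpace ℂ E]
  {D : Submodule ℂ (E × E)} {S C P : E →ₗ[ℂ] E} {g g₁ g₂ y : E} {κ β μ : ℝ}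

theorem IsShearSolution.smul (hg : IsShearSolution D S κ β μ g g₁ g₂ y) (c : ℂ) :
    IsShearSolution D S κ β μ (c • g) (c • g₁) (c • g₂) (c • y) where
  deriv := D.smul_mem c hg.deriv
  deriv_deriv := D.smul_mem c hg.deriv_deriv
  eq := by rw [hg.eq, map_smul]; module

namespace IsSinCosPair

theorem norm_sin_le (h : IsSinCosPair D S C P) (x : E) : ‖S x‖ ≤ ‖x‖ :=
  le_of_sq_le_sq (by linarith [h.sq_add_sq_le x, sq_nonneg ‖C x‖]) (norm_nonneg x)

theorem norm_sin_add_smul_le (h : IsSinCosPair D S C P) (hμ : |μ| ≤ 1) (x : E) :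
    ‖S x + (μ : ℂ) • x‖ ≤ 2 * ‖x‖ := by
  have hsmul : ‖(μ : ℂ) • x‖ ≤ ‖x‖ := by
    rw [norm_smul, Complex.norm_real]
    exact mul_le_of_le_one_left (norm_nonneg x) hμ
  linarith [norm_add_le (S x) ((μ : ℂ) • x), h.norm_sin_le x]

theorem deriv_shift (h : IsSinCosPair D S C P) (hg : (g, g₁) ∈ D) (μ : ℂ) :
    (S g - μ • g, S g₁ + C g - μ • g₁) ∈ D :=
  D.sub_mem (h.deriv_sin hg) (D.smul_mem μ hg)

theorem exists_abs_le_one_norm_shift_le (h : IsSinCosPair D S C P) (x : E) (μ : ℝ) :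
    ∃ μ₀ : ℝ, |μ₀| ≤ 1 ∧ ‖S x - (μ₀ : ℂ) • x‖ ≤ ‖S x - (μ : ℂ) • x‖ := by
  have hsq (m : ℝ) :
      ‖S x - (m : ℂ) • x‖ ^ 2 = ‖S x‖ ^ 2 - 2 * m * (inner ℂ (S x) x).re + m ^ 2 * ‖x‖ ^ 2 := by
    rw [norm_sub_sq (𝕜 := ℂ), norm_smul, mul_pow, inner_smul_right, Complex.norm_real,
      Real.norm_eq_abs, sq_abs]
    simp only [RCLike.re_eq_complex_re, Complex.re_ofReal_mul]
    ring
  have hrange : |(inner ℂ (S x) x).re| ≤ ‖x‖ ^ 2 := by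
    rw [sq]
    exact (abs_re_inner_le _ _).trans
      (mul_le_mul_of_nonneg_right (h.norm_sin_le x) (norm_nonneg x))
  rw [abs_le] at hrange
  have hle {m : ℝ} (hm : 0 ≤ (μ - m) * ((μ + m) * ‖x‖ ^ 2 - 2 * (inner ℂ (S x) x).re)) :
      ‖S x - (m : ℂ) • x‖ ≤ ‖S x - (μ : ℂ) • x‖ :=
    le_of_sq_le_sq (by rw [hsq, hsq]; linarith) (norm_nonneg _)
  rcases le_or_gt |μ| 1 with hμ | hμ
  · exact ⟨μ, hμ, le_rfl⟩
  rcases lt_abs.mp hμ with hμ | hμ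
  · refine ⟨1, by norm_num, hle (mul_nonneg (by linarith) ?_)⟩
    nlinarith [sq_nonneg ‖x‖]
  · refine ⟨-1, by norm_num, hle (mul_nonneg_of_nonpos_of_nonpos (by linarith) ?_)⟩
    nlinarith [sq_nonneg ‖x‖]

theorem re_inner_eq_energy (h : IsSinCosPair D S C P)
    (hg : IsShearSolution D S κ β μ g g₁ g₂ y) :
    (inner ℂ g y).re = ‖g₁‖ ^ 2 + κ * ‖g‖ ^ 2 := by
  have hparts : inner ℂ g g₂ = -inner ℂ g₁ g₁ := by
    rw [h.inner_deriv hg.deriv hg.deriv_deriv, neg_neg]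
  have hreal : (inner ℂ g (S g)).im = 0 := by
    rw [← h.sin_symm g g]
    exact im_inner_apply_self h.sin_symm g
  rw [hg.eq, ← re_inner_self, ← re_inner_self]
  simp [hparts, hreal, im_ofReal_sq]

theorem energy_le (h : IsSinCosPair D S C P) (hg : IsShearSolution D S κ β μ g g₁ g₂ y) :
    ‖g₁‖ ^ 2 + κ * ‖g‖ ^ 2 ≤ ‖y‖ * ‖g‖ := by
  rw [← h.re_inner_eq_energy hg, re_inner_comm]
  exact (le_abs_self _).trans (abs_re_inner_le y g)

theorem im_inner_shift_deriv_deriv (h : IsSinCosPair D S C P) (hg : (g, g₁) ∈ D)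
    (hg₁ : (g₁, g₂) ∈ D) (μ : ℝ) :
    (inner ℂ (S g - (μ : ℂ) • g) g₂).im = -(inner ℂ (C g) g₁).im := by
  rw [← neg_neg (inner ℂ (S g - (μ : ℂ) • g) g₂), ← h.inner_deriv (h.deriv_shift hg μ) hg₁]
  simp [im_inner_apply_self h.sin_symm, im_ofReal_sq]

theorem sq_norm_shift_le (h : IsSinCosPair D S C P)
    (hg : IsShearSolution D S κ β μ g g₁ g₂ y) :
    |β| * ‖S g - (μ : ℂ) • g‖ ^ 2 ≤ ‖y‖ * ‖S g - (μ : ℂ) • g‖ + ‖C g‖ * ‖g₁‖ := by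
  have hparts := h.im_inner_shift_deriv_deriv hg.deriv hg.deriv_deriv μ
  have hreal : (inner ℂ (S g - (μ : ℂ) • g) g).im = 0 := by
    simp [im_inner_apply_self h.sin_symm, im_ofReal_sq]
  set z := S g - (μ : ℂ) • g with hz
  have hkey : β * ‖z‖ ^ 2 = (inner ℂ z y).im - (inner ℂ (C g) g₁).im := by
    rw [hg.eq, ← hz, ← re_inner_self z]
    simp [hparts, hreal, im_ofReal_sq]
  calc |β| * ‖z‖ ^ 2 = |(inner ℂ z y).im - (inner ℂ (C g) g₁).im| := by
        rw [← hkey, abs_mul, abs_of_nonneg (sq_nonneg ‖z‖)]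
    _ ≤ |(inner ℂ z y).im| + |(inner ℂ (C g) g₁).im| := abs_sub _ _
    _ ≤ ‖y‖ * ‖z‖ + ‖C g‖ * ‖g₁‖ := by
        rw [mul_comm ‖y‖]
        exact add_le_add (abs_im_inner_le _ _) (abs_im_inner_le _ _)

theorem sq_norm_deriv_deriv_le (h : IsSinCosPair D S C P) (hκ : 0 ≤ κ)
    (hg : IsShearSolution D S κ β μ g g₁ g₂ y) :
    ‖g₂‖ ^ 2 ≤ ‖y‖ * ‖g₂‖ + |β| * (‖C g‖ * ‖g₁‖) := by
  have hparts := h.im_inner_shift_deriv_deriv hg.deriv hg.deriv_deriv μ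
  have hself : (inner ℂ g₂ g).re = -‖g₁‖ ^ 2 := by
    rw [h.inner_deriv hg.deriv_deriv hg.deriv, Complex.neg_re, re_inner_self]
  rw [im_inner_comm, neg_inj] at hparts
  set z := S g - (μ : ℂ) • g with hz
  have hkey : ‖g₂‖ ^ 2 + κ * ‖g₁‖ ^ 2 = -(inner ℂ g₂ y).re - β * (inner ℂ (C g) g₁).im := by
    rw [hg.eq, ← hz, ← re_inner_self g₂, inner_add_right, inner_add_right, inner_neg_right,
      inner_smul_right, inner_smul_right]
    simp only [hself, hparts, Complex.add_re, Complex.neg_re, Complex.re_ofReal_mul, mul_assoc,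
      Complex.I_mul_re, Complex.im_ofReal_mul]
    ring
  have hy : -(inner ℂ g₂ y).re ≤ ‖y‖ * ‖g₂‖ := by
    rw [mul_comm]
    exact (neg_le_abs _).trans (abs_re_inner_le g₂ y)
  have hcos : -(β * (inner ℂ (C g) g₁).im) ≤ |β| * (‖C g‖ * ‖g₁‖) := by
    refine (neg_le_abs _).trans ?_
    rw [abs_mul]
    exact mul_le_mul_of_nonneg_left (abs_im_inner_le _ _) (abs_nonneg β)
  linarith [mul_nonneg hκ (sq_nonneg ‖g₁‖)]

theorem sq_norm_cos_add_le (h : IsSinCosPair D S C P) (hg : (g, g₁) ∈ D) (μ : ℝ) :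
    ‖C g‖ ^ 2 + (inner ℂ (P g) g).re ≤ ‖S g - (μ : ℂ) • g‖ * (2 * ‖C g₁‖ + ‖S g‖) := by
  have hshift := h.inner_deriv (h.deriv_shift hg μ) (h.deriv_cos hg)
  have hcomm := h.inner_deriv (h.deriv_comm g) hg
  set z := S g - (μ : ℂ) • g with hz
  have hkey : ‖C g‖ ^ 2 + (inner ℂ (P g) g).re = -(inner ℂ z (C g₁ - S g + C g₁)).re := by
    rw [inner_add_right, ← neg_neg (inner ℂ z (C g₁ - S g)), ← hshift, hcomm, ← h.cos_symm z g₁,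
      hz, ← re_inner_self]
    simp only [map_sub, map_smul, inner_add_left, inner_sub_left, inner_smul_left,
      Complex.conj_ofReal, Complex.add_re, Complex.sub_re, Complex.neg_re,
      Complex.re_ofReal_mul]
    rw [h.sin_symm g₁ (C g), h.cos_symm g g₁, re_inner_comm g₁ (C g), re_inner_comm g₁ (S (C g)),
      ← h.cos_symm g g₁]
    ring
  have hnorm : ‖C g₁ - S g + C g₁‖ ≤ 2 * ‖C g₁‖ + ‖S g‖ := by
    linarith [norm_add_le (C g₁ - S g) (C g₁), norm_sub_le (C g₁) (S g)]
  calc _ ≤ ‖z‖ * ‖C g₁ - S g + C g₁‖ := hkey ▸ (neg_le_abs _).trans (abs_re_inner_le _ _)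
    _ ≤ _ := mul_le_mul_of_nonneg_left hnorm (norm_nonneg z)

theorem sq_norm_sin_add_le (h : IsSinCosPair D S C P) (hg : (g, g₁) ∈ D) :
    ‖S g‖ ^ 2 + (inner ℂ (P g) g).re ≤ ‖C g‖ ^ 2 + 2 * (‖C g‖ * ‖g₁‖) := by
  have hsin := h.inner_deriv (h.deriv_sin hg) (h.deriv_cos hg)
  have hcomm := h.inner_deriv (h.deriv_comm g) hg
  have hkey : ‖S g‖ ^ 2 + (inner ℂ (P g) g).re =
      ‖C g‖ ^ 2 + 2 * (inner ℂ (C g) (S g₁)).re := by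
    have hsplit : inner ℂ (S g) (S g) =
        inner ℂ (S g₁ + C g) (C g) + inner ℂ (S g) (C g₁) := by
      rw [hsin, inner_sub_right]
      ring
    rw [hcomm, ← re_inner_self (S g), ← re_inner_self (C g), hsplit, ← h.cos_symm (S g) g₁]
    simp only [inner_add_left, inner_sub_left, Complex.add_re, Complex.neg_re, Complex.sub_re]
    rw [re_inner_comm (S g₁) (C g), h.sin_symm (C g) g₁]
    ring
  have hle : (inner ℂ (C g) (S g₁)).re ≤ ‖C g‖ * ‖g₁‖ :=
    (le_abs_self _).trans <| (abs_re_inner_le _ _).trans <|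
      mul_le_mul_of_nonneg_left (h.norm_sin_le g₁) (norm_nonneg _)
  linarith

theorem sq_norm_cos_deriv_le (h : IsSinCosPair D S C P) (hg : (g, g₁) ∈ D) (hg₁ : (g₁, g₂) ∈ D)
    (hμ : |μ| ≤ 1) :
    ‖C g₁‖ ^ 2 ≤ (1 - μ ^ 2) * ‖g₁‖ ^ 2 +
      ‖S g - (μ : ℂ) • g‖ * (2 * ‖g₂‖ + ‖C g₁‖) + 2 * (‖C g‖ * ‖g₁‖) := by
  have hshift : (S g₁ + (μ : ℂ) • g₁, S g₂ + C g₁ + (μ : ℂ) • g₂) ∈ D :=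
    D.add_mem (h.deriv_sin hg₁) (D.smul_mem (μ : ℂ) hg₁)
  have hparts := h.inner_deriv (h.deriv_shift hg μ) hshift
  set z := S g - (μ : ℂ) • g
  have hkey : ‖S g₁‖ ^ 2 - μ ^ 2 * ‖g₁‖ ^ 2 =
      -(inner ℂ z (S g₂ + C g₁ + (μ : ℂ) • g₂)).re -
        (inner ℂ (C g) (S g₁ + (μ : ℂ) • g₁)).re := by
    rw [← Complex.neg_re, ← hparts, ← re_inner_self, ← re_inner_self]
    simp only [inner_add_left, inner_add_right, inner_sub_left, inner_smul_left, inner_smul_right,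
      Complex.conj_ofReal, Complex.add_re, Complex.sub_re, Complex.re_ofReal_mul]
    rw [re_inner_comm g₁ (S g₁)]
    ring
  have hle₁ : (inner ℂ z (S g₂ + C g₁ + (μ : ℂ) • g₂)).re ≤ ‖z‖ * (2 * ‖g₂‖ + ‖C g₁‖) := by
    refine (le_abs_self _).trans <| (abs_re_inner_le _ _).trans ?_
    rw [add_right_comm]
    gcongr
    exact (norm_add_le _ _).trans (add_le_add_left (h.norm_sin_add_smul_le hμ g₂) _)
  have hle₂ : (inner ℂ (C g) (S g₁ + (μ : ℂ) • g₁)).re ≤ 2 * (‖C g‖ * ‖g₁‖) := by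
    rw [mul_left_comm]
    refine (le_abs_self _).trans <| (abs_re_inner_le _ _).trans ?_
    gcongr
    exact h.norm_sin_add_smul_le hμ g₁
  linarith [h.sq_add_sq_le g₁]

theorem gap_le (h : IsSinCosPair D S C P) (hμ : |μ| ≤ 1)
    (hlow : ‖g‖ ^ 2 ≤ ‖S g‖ ^ 2 + ‖C g‖ ^ 2 + 4 * (inner ℂ (P g) g).re) :
    (1 - μ ^ 2) * ‖g‖ ^ 2 ≤
      ‖C g‖ ^ 2 + 4 * (inner ℂ (P g) g).re + 2 * (‖S g - (μ : ℂ) • g‖ * ‖g‖) := by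
  have hkey : ‖S g‖ ^ 2 - μ ^ 2 * ‖g‖ ^ 2 =
      (inner ℂ (S g - (μ : ℂ) • g) (S g + (μ : ℂ) • g)).re := by
    rw [← re_inner_self, ← re_inner_self]
    simp only [inner_add_right, inner_sub_left, inner_smul_left, inner_smul_right,
      Complex.conj_ofReal, Complex.add_re, Complex.sub_re, Complex.re_ofReal_mul]
    rw [re_inner_comm g (S g)]
    ring
  have hle : (inner ℂ (S g - (μ : ℂ) • g) (S g + (μ : ℂ) • g)).re ≤
      2 * (‖S g - (μ : ℂ) • g‖ * ‖g‖) := by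
    rw [mul_left_comm]
    refine (le_abs_self _).trans <| (abs_re_inner_le _ _).trans ?_
    gcongr
    exact h.norm_sin_add_smul_le hμ g
  linarith

end IsSinCosPair

end Commutator

section RescaledSystem

variable {e r v θ p s w σ : ℝ}

theorem rescaled_cos_deriv_le (he : 0 ≤ e) (he' : e ≤ 1 / 32) (hr : 1 ≤ r) (hv : 0 ≤ v)
    (hve : v ≤ e ^ 2) (hp : 0 ≤ p) (hs : 0 ≤ s) (hσ : 0 ≤ σ) (hθp : θ ^ 2 + p ≤ r ^ 4)
    (hvθ : v * θ ≤ (e * r) ^ 2) (hsr : s ≤ 2 * (e * r)) (hwr : w ≤ 2 * (e * r))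
    (h : σ ^ 2 ≤ v ^ 2 * (θ ^ 2 + 4 * p + 2 * s) + s * (2 * w + σ) + 2 * (v * θ)) :
    σ ≤ 8 * (e * r ^ 2) := by
  have her : e * r ≤ e * r ^ 2 := by nlinarith
  have hvele : v ≤ e := hve.trans (by nlinarith)
  have hgap : v ^ 2 * (θ ^ 2 + 4 * p + 2 * s) ≤ e ^ 2 * (6 * r ^ 4) := by
    have hsr4 : s ≤ r ^ 4 := by nlinarith [le_self_pow₀ hr (four_ne_zero)]
    gcongr
    nlinarith
  have hcross : s * (2 * w + σ) ≤ 2 * (e * r) * (2 * (2 * (e * r)) + σ) := by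
    calc s * (2 * w + σ) ≤ s * (2 * (2 * (e * r)) + σ) := by gcongr
      _ ≤ _ := by gcongr
  have hsq : (e * r) ^ 2 ≤ (e * r ^ 2) ^ 2 := by gcongr
  have hσr : e * r * σ ≤ e * r ^ 2 * σ := by gcongr
  have hsystem : σ ^ 2 ≤ 2 * (e * r ^ 2) * σ + (4 * (e * r ^ 2)) ^ 2 := by
    linarith
  have := le_two_mul_of_sq_le (by nlinarith) (by positivity) hsystem
  linarith

theorem rescaled_sq_add_le (he : 0 ≤ e) (he' : e ≤ 1 / 32) (hr : 1 ≤ r) (hv : 0 ≤ v)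
    (hve : v ≤ e ^ 2) (hp : 0 ≤ p) (hs : 0 ≤ s) (hσ : 0 ≤ σ) (hθp : θ ^ 2 + p ≤ r ^ 4)
    (hshift : s ^ 2 ≤ e ^ 4 * s + v * θ) (hderiv : w ^ 2 ≤ e ^ 4 * w + v * θ)
    (hcos : θ ^ 2 + p ≤ s * (2 * σ + 1))
    (hcosd : σ ^ 2 ≤ v ^ 2 * (θ ^ 2 + 4 * p + 2 * s) + s * (2 * w + σ) + 2 * (v * θ)) :
    θ ^ 2 + p ≤ r ^ 4 / 8 := by
  have hvθ : v * θ ≤ (e * r) ^ 2 := by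
    have hθr : θ ≤ r ^ 2 := le_of_sq_le_sq (by linarith) (by positivity)
    rw [mul_pow]
    nlinarith
  have he4 : e ^ 4 ≤ e * r :=
    (pow_le_of_le_one he (by linarith) four_ne_zero).trans (le_mul_of_one_le_right he hr)
  have hsr : s ≤ 2 * (e * r) := le_two_mul_of_sq_le he4 (by positivity) (by linarith)
  have hwr : w ≤ 2 * (e * r) := le_two_mul_of_sq_le he4 (by positivity) (by linarith)
  have hσr : 2 * σ + 1 ≤ 2 * r ^ 2 := by
    have := rescaled_cos_deriv_le he he' hr hv hve hp hs hσ hθp hvθ hsr hwr hcosd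
    nlinarith
  calc θ ^ 2 + p ≤ s * (2 * σ + 1) := hcos
    _ ≤ 2 * (e * r) * (2 * r ^ 2) := by gcongr
    _ = 4 * e * r ^ 3 := by ring
    _ ≤ 4 * (1 / 32) * r ^ 4 := by gcongr; norm_num
    _ = r ^ 4 / 8 := by ring

theorem rescaled_system_false (he : 0 ≤ e) (he' : e ≤ 1 / 32) (hv : 0 ≤ v) (hve : v ≤ e ^ 2)
    (hp : 0 ≤ p) (hs : 0 ≤ s) (hσ : 0 ≤ σ)
    (hshift : s ^ 2 ≤ e ^ 4 * s + v * θ) (hderiv : w ^ 2 ≤ e ^ 4 * w + v * θ)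
    (hcos : θ ^ 2 + p ≤ s * (2 * σ + 1))
    (hcosd : σ ^ 2 ≤ v ^ 2 * (θ ^ 2 + 4 * p + 2 * s) + s * (2 * w + σ) + 2 * (v * θ))
    (hlow : 1 ≤ 2 * θ ^ 2 + 2 * (v * θ) + 3 * p) : False := by
  obtain ⟨r, hr0, hr⟩ := exists_nonneg_pow_eq four_ne_zero
    (zero_le_one.trans (le_max_left 1 (θ ^ 2 + p)))
  have hr1 : 1 ≤ r := (one_le_pow_iff_of_nonneg hr0 four_ne_zero).mp (hr ▸ le_max_left _ _)
  have hsmall := rescaled_sq_add_le he he' hr1 hv hve hp hs hσ (hr ▸ le_max_right _ _)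
    hshift hderiv hcos hcosd
  have hθ : θ ≤ 1 := by
    rcases max_choice 1 (θ ^ 2 + p) with h | h <;> rw [hr, h] at hsmall <;> nlinarith
  have hθp : θ ^ 2 + p ≤ 1 / 8 := by
    rcases max_choice 1 (θ ^ 2 + p) with h | h <;> rw [hr, h] at hsmall <;> nlinarith
  nlinarith [mul_le_mul hve hθ]

theorem commutator_system_false {M H V z τ W m : ℝ} (he : 0 ≤ e) (he' : e ≤ 1 / 32)
    (hM : 1 ≤ M) (hV : 0 ≤ V) (hz : 0 ≤ z) (hW : 0 ≤ W) (hp : 0 ≤ p) (hσ : 0 ≤ σ)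
    (hH : H ≤ e ^ 4 * M ^ 2) (henergy : V ^ 2 ≤ H)
    (hshift : M ^ 4 * z ^ 2 ≤ H * z + τ * V) (hderiv : W ^ 2 ≤ H * W + M ^ 4 * (τ * V))
    (hcos : τ ^ 2 + p ≤ z * (2 * σ + 1))
    (hcosd : σ ^ 2 ≤ m * V ^ 2 + z * (2 * W + σ) + 2 * (τ * V))
    (hgap : m ≤ τ ^ 2 + 4 * p + 2 * z) (hlow : 1 ≤ 2 * τ ^ 2 + 2 * (τ * V) + 3 * p) : False := by
  have hM0 : 0 < M := by linarith
  have hM2 : 1 ≤ M ^ 2 := one_le_pow₀ hM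
  have hvθ : V / M * (τ * M) = τ * V := by field_simp
  have hve : V / M ≤ e ^ 2 := by
    rw [div_le_iff₀ hM0]
    refine le_of_sq_le_sq (henergy.trans (hH.trans_eq ?_)) (by positivity)
    ring
  refine rescaled_system_false (v := V / M) (θ := τ * M) (p := p * M ^ 2) (s := z * M ^ 2)
    (w := W / M ^ 2) (σ := σ) he he' (by positivity) hve (by positivity) (by positivity) hσ
    ?_ ?_ ?_ ?_ ?_
  · rw [hvθ]
    linarith [mul_le_mul_of_nonneg_right hH hz]
  · rw [hvθ, div_pow, div_le_iff₀ (by positivity)]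
    have hHW := mul_le_mul_of_nonneg_right hH hW
    calc W ^ 2 ≤ e ^ 4 * M ^ 2 * W + M ^ 4 * (τ * V) := by linarith
      _ = (e ^ 4 * (W / M ^ 2) + τ * V) * (M ^ 2) ^ 2 := by field_simp
  · linarith [mul_le_mul_of_nonneg_right hcos (sq_nonneg M)]
  · have hmV := mul_le_mul_of_nonneg_right hgap (sq_nonneg V)
    have hzσ : z * σ ≤ z * M ^ 2 * σ :=
      mul_le_mul_of_nonneg_right (le_mul_of_one_le_right hz hM2) hσ
    calc σ ^ 2 ≤ (τ ^ 2 + 4 * p + 2 * z) * V ^ 2 + (2 * (z * W) + z * M ^ 2 * σ) + 2 * (τ * V) := by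
          linarith
      _ = _ := by field_simp
  · rw [hvθ]
    have hτM : τ ^ 2 ≤ (τ * M) ^ 2 := by
      rw [mul_pow]
      exact le_mul_of_one_le_right (sq_nonneg τ) hM2
    linarith [le_mul_of_one_le_right hp hM2]

end RescaledSystem

namespace IsSinCosPair

variable {E : Type*} [NormedAddCommGroup E] [InnerProductSpace ℂ E]
  {D : Submodule ℂ (E × E)} {S C P : E →ₗ[ℂ] E} {g g₁ g₂ y : E} {β μ : ℝ}

theorem sqrt_abs_le_norm_of_norm_eq_one (h : IsSinCosPair D S C P)
    (hg : IsShearSolution D S 0 β μ g g₁ g₂ y) (hgap : ‖g‖ ≤ ‖g₁‖)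
    (hlow : ‖g‖ ^ 2 ≤ ‖S g‖ ^ 2 + ‖C g‖ ^ 2 + 4 * (inner ℂ (P g) g).re) (hnorm : ‖g‖ = 1) :
    (1 / 32) ^ 4 * √|β| ≤ ‖y‖ := by
  obtain ⟨μ₀, hμ₀, hz⟩ := h.exists_abs_le_one_norm_shift_le g μ
  have henergy := h.energy_le hg
  have hshift := h.sq_norm_shift_le hg
  have hderiv := h.sq_norm_deriv_deriv_le le_rfl hg
  have hcos := h.sq_norm_cos_add_le hg.deriv μ₀
  have hsin := h.sq_norm_sin_add_le hg.deriv
  have hcosd := h.sq_norm_cos_deriv_le hg.deriv hg.deriv_deriv hμ₀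
  have hμgap := h.gap_le hμ₀ hlow
  have hSg := h.norm_sin_le g
  have hP := h.comm_nonneg g
  simp only [hnorm, add_zero, mul_one, one_pow] at henergy hμgap hgap hlow hSg
  obtain ⟨M, hM, hβM⟩ := exists_nonneg_pow_eq four_ne_zero (abs_nonneg β)
  have hsqrt : √|β| = M ^ 2 := by
    rw [← hβM, show M ^ 4 = (M ^ 2) ^ 2 by ring, Real.sqrt_sq (sq_nonneg M)]
  rw [hsqrt]
  by_contra! hlt
  have hM1 : 1 ≤ M := by
    by_contra! hM1
    nlinarith
  rw [← hβM] at hshift hderiv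
  refine commutator_system_false (e := 1 / 32) (by norm_num) le_rfl hM1 (norm_nonneg g₁)
    (norm_nonneg (S g - (μ : ℂ) • g)) (norm_nonneg g₂) hP (norm_nonneg (C g₁)) hlt.le
    (by linarith) hshift hderiv ?_ (hcosd.trans ?_) (hμgap.trans ?_) (by linarith)
  · exact hcos.trans (mul_le_mul hz (by linarith) (by positivity) (norm_nonneg _))
  · gcongr
  · gcongr

theorem sqrt_abs_mul_norm_le (h : IsSinCosPair D S C P)
    (hg : IsShearSolution D S 0 β μ g g₁ g₂ y) (hgap : ‖g‖ ≤ ‖g₁‖)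
    (hlow : ‖g‖ ^ 2 ≤ ‖S g‖ ^ 2 + ‖C g‖ ^ 2 + 4 * (inner ℂ (P g) g).re) :
    (1 / 32) ^ 4 * √|β| * ‖g‖ ≤ ‖y‖ := by
  rcases eq_or_ne g 0 with rfl | hg0
  · simp
  have hpos : 0 < ‖g‖ := norm_pos_iff.mpr hg0
  have hnorm (x : E) : ‖((‖g‖⁻¹ : ℝ) : ℂ) • x‖ = ‖g‖⁻¹ * ‖x‖ := by
    rw [norm_smul, Complex.norm_real, norm_inv, norm_norm]
  have hunit := h.sqrt_abs_le_norm_of_norm_eq_one (hg.smul ((‖g‖⁻¹ : ℝ) : ℂ))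
    (by rw [hnorm, hnorm]; gcongr)
    (by
      simp only [map_smul, hnorm, inner_smul_left, inner_smul_right, Complex.conj_ofReal,
        Complex.re_ofReal_mul]
      linarith [mul_le_mul_of_nonneg_left hlow (sq_nonneg ‖g‖⁻¹)])
    (by rw [hnorm, inv_mul_cancel₀ hpos.ne'])
  rwa [hnorm, inv_mul_eq_div, le_div_iff₀ hpos] at hunit

theorem sqrt_abs_mul_norm_le_norm_sub_smul (h : IsSinCosPair D S C P) (hg : (g, g₁) ∈ D)
    (hg₁ : (g₁, g₂) ∈ D) (hgap : ‖g‖ ≤ ‖g₁‖)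
    (hlow : ‖g‖ ^ 2 ≤ ‖S g‖ ^ 2 + ‖C g‖ ^ 2 + 4 * (inner ℂ (P g) g).re)
    {a : ℝ} (ha : 0 < a) (b lam : ℝ) :
    (1 / 32) ^ 4 * √|a * b| * ‖g‖ ≤
      ‖-((a : ℂ) • g₂) + (Complex.I * b) • S g - (Complex.I * lam) • g‖ := by
  rcases eq_or_ne b 0 with rfl | hb
  · simp
  set y := -g₂ + ((0 : ℝ) : ℂ) • g +
    (Complex.I * ((b / a : ℝ) : ℂ)) • (S g - ((lam / b : ℝ) : ℂ) • g) with hy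
  have hbound := h.sqrt_abs_mul_norm_le ⟨hg, hg₁, hy⟩ hgap hlow
  have hscale : -((a : ℂ) • g₂) + (Complex.I * b) • S g - (Complex.I * lam) • g =
      (a : ℂ) • y := by
    have ha' : (a : ℂ) ≠ 0 := Complex.ofReal_ne_zero.mpr ha.ne'
    have hb' : (b : ℂ) ≠ 0 := Complex.ofReal_ne_zero.mpr hb
    rw [hy, Complex.ofReal_zero, zero_smul, add_zero]
    push_cast
    match_scalars <;> field_simp
  have hsqrt : √|a * b| = a * √|b / a| := by
    rw [show a * b = a ^ 2 * (b / a) by field_simp, abs_mul, abs_of_nonneg (sq_nonneg a),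
      Real.sqrt_mul (sq_nonneg a), Real.sqrt_sq ha.le]
  rw [hscale, norm_smul, Complex.norm_real, Real.norm_of_nonneg ha.le, hsqrt]
  linarith [mul_le_mul_of_nonneg_left hbound ha.le]

end IsSinCosPair

/-! ### Fourier multipliers and multiplication operators on the torus -/

theorem ext_inner_expL2 {f g : L2T} (h : ∀ n, inner ℂ (expL2 n) f = inner ℂ (expL2 n) g) :
    f = g := by
  rw [← sub_eq_zero]
  exact eq_zero_of_inner_expL2 _ fun n => by rw [inner_sub_right, h, sub_self]

theorem hasSum_inner_expL2 (f g : L2T) :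
    HasSum (fun n : ℤ => ((2 * Real.pi : ℝ) : ℂ)⁻¹ *
      (inner ℂ f (expL2 n) * inner ℂ (expL2 n) g)) (inner ℂ f g) := by
  have hsqrt : (((√(2 * Real.pi))⁻¹ : ℝ) : ℂ) * (((√(2 * Real.pi))⁻¹ : ℝ) : ℂ) =
      ((2 * Real.pi : ℝ) : ℂ)⁻¹ := by
    rw [← Complex.ofReal_mul, ← mul_inv, Real.mul_self_sqrt Real.two_pi_pos.le,
      Complex.ofReal_inv]
  have hcoef (n : ℤ) : ((2 * Real.pi : ℝ) : ℂ)⁻¹ * (inner ℂ f (expL2 n) * inner ℂ (expL2 n) g) =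
      inner ℂ f (expBasis n) * inner ℂ (expBasis n) g := by
    rw [inner_expBasis, expBasis_apply, inner_smul_right, ← hsqrt]
    ring
  simpa only [hcoef] using expBasis.hasSum_inner_mul_inner f g

theorem inner_eq_of_inner_expL2 {f g f' g' : L2T}
    (h : ∀ n, inner ℂ f (expL2 n) * inner ℂ (expL2 n) g =
      inner ℂ f' (expL2 n) * inner ℂ (expL2 n) g') : inner ℂ f g = inner ℂ f' g' := by
  rw [← (hasSum_inner_expL2 f g).tsum_eq, ← (hasSum_inner_expL2 f' g').tsum_eq]
  exact tsum_congr fun n => by rw [h]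

theorem hasSum_re_inner_of_symbol {m : ℤ → ℝ} {f g : L2T}
    (h : ∀ n, inner ℂ (expL2 n) g = m n * inner ℂ (expL2 n) f) :
    HasSum (fun n : ℤ => m n * ((2 * Real.pi)⁻¹ * ‖inner ℂ (expL2 n) f‖ ^ 2))
      (inner ℂ g f).re := by
  convert Complex.reCLM.hasSum (hasSum_inner_expL2 g f) using 1
  · ext n
    rw [← inner_conj_symm g (expL2 n), h, map_mul (starRingEnd ℂ), Complex.conj_ofReal,
      mul_assoc (m n : ℂ), ← Complex.normSq_eq_conj_mul_self, ← Complex.ofReal_inv,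
      ← Complex.ofReal_mul, ← Complex.ofReal_mul, Complex.reCLM_apply, Complex.ofReal_re,
      Complex.normSq_eq_norm_sq]
    ring
  · rfl

theorem hasSum_norm_sq (f : L2T) :
    HasSum (fun n : ℤ => (2 * Real.pi)⁻¹ * ‖inner ℂ (expL2 n) f‖ ^ 2) (‖f‖ ^ 2) := by
  have h := hasSum_re_inner_of_symbol (m := 1) (f := f) (g := f) (by simp)
  rw [re_inner_self] at h
  simpa only [Pi.one_apply, one_mul] using h

theorem norm_le_of_norm_inner_expL2_le {f g : L2T} {K : ℝ} (hK : 0 ≤ K)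
    (h : ∀ n, ‖inner ℂ (expL2 n) f‖ ≤ K * ‖inner ℂ (expL2 n) g‖) : ‖f‖ ≤ K * ‖g‖ := by
  refine le_of_sq_le_sq ?_ (by positivity)
  rw [mul_pow]
  refine hasSum_le (fun n => ?_) (hasSum_norm_sq f) ((hasSum_norm_sq g).mul_left (K ^ 2))
  rw [mul_left_comm, ← mul_pow]
  have hn := h n
  gcongr

/-- The Fourier multiplier with bounded real symbol `m`. -/
def fourierMultiplier {m : ℤ → ℝ} {K : ℝ} (hm : ∀ n, |m n| ≤ K) : L2T →L[ℂ] L2T :=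
  have hspec := fun f =>
    (exists_multiplier (fun n => (m n : ℂ)) K (by simpa using hm) f).choose_spec
  LinearMap.mkContinuous
    { toFun f := (exists_multiplier (fun n => (m n : ℂ)) K (by simpa using hm) f).choose
      map_add' f g := ext_inner_expL2 fun n => by
        rw [inner_add_right, hspec, hspec, hspec, inner_add_right, mul_add]
      map_smul' c f := ext_inner_expL2 fun n => by
        rw [RingHom.id_apply, inner_smul_right, hspec, hspec, inner_smul_right]
        ring }
    K fun f => norm_le_of_norm_inner_expL2_le ((abs_nonneg _).trans (hm 0)) fun n => by
      rw [LinearMap.coe_mk, AddHom.coe_mk, hspec, norm_mul, Complex.norm_real]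
      exact mul_le_mul_of_nonneg_right (hm n) (norm_nonneg _)

theorem inner_expL2_fourierMultiplier {m : ℤ → ℝ} {K : ℝ} (hm : ∀ n, |m n| ≤ K) (f : L2T)
    (n : ℤ) : inner ℂ (expL2 n) (fourierMultiplier hm f) = m n * inner ℂ (expL2 n) f :=
  (exists_multiplier (fun n => (m n : ℂ)) K (by simpa using hm) f).choose_spec n

theorem isSymmetric_fourierMultiplier {m : ℤ → ℝ} {K : ℝ} (hm : ∀ n, |m n| ≤ K) :
    (fourierMultiplier hm : L2T →ₗ[ℂ] L2T).IsSymmetric := by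
  intro f g
  refine inner_eq_of_inner_expL2 fun n => ?_
  rw [← inner_conj_symm _ (expL2 n), ContinuousLinearMap.coe_coe, inner_expL2_fourierMultiplier,
    inner_expL2_fourierMultiplier, map_mul, Complex.conj_ofReal, inner_conj_symm]
  ring

theorem inner_expL2_helmholtzInv {s : ℝ} (hs : 0 < s) (f : L2T) (n : ℤ) :
    inner ℂ (expL2 n) (helmholtzInv s f) =
      ((s + (n : ℝ) ^ 2 : ℝ) : ℂ)⁻¹ * inner ℂ (expL2 n) f := by
  obtain ⟨u, hu⟩ := (helmholtz_bijective hs).2 f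
  have hne : ((s + (n : ℝ) ^ 2 : ℝ) : ℂ) ≠ 0 := Complex.ofReal_ne_zero.mpr (by positivity)
  rw [(helmholtzInv_eq_iff hs f u).mpr hu, ← hu, inner_expL2_helmholtz, inv_mul_cancel_left₀ hne]

/-- Multiplication by a continuous function, as an operator on `L²` of the torus. -/
def mulC : C(Torus, ℂ) →ₗ[ℂ] L2T →L[ℂ] L2T :=
  (((ContinuousLinearMap.mul ℂ ℂ).holderL volume ⊤ 2 2).comp
    (ContinuousMap.toLp ⊤ volume ℂ)).toLinearMap

theorem coeFn_mulC (g : C(Torus, ℂ)) (f : L2T) : mulC g f =ᵐ[volume] fun x => g x * f x := by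
  filter_upwards [(ContinuousLinearMap.mul ℂ ℂ).coeFn_holder (r := 2)
    (ContinuousMap.toLp ⊤ volume ℂ g) f, ContinuousMap.coeFn_toLp (p := ⊤) (𝕜 := ℂ) volume g]
    with x hx hg
  rw [← hg]
  exact hx

theorem mulC_mulC (g h : C(Torus, ℂ)) (f : L2T) : mulC g (mulC h f) = mulC (g * h) f := by
  apply Lp.ext
  filter_upwards [coeFn_mulC g (mulC h f), coeFn_mulC h f, coeFn_mulC (g * h) f] with x hg hh hgh
  rw [hg, hh, hgh, ContinuousMap.mul_apply, mul_assoc]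

theorem inner_mulC_left (g : C(Torus, ℂ)) (f k : L2T) :
    inner ℂ (mulC g f) k = inner ℂ f (mulC (star g) k) := by
  rw [L2.inner_def, L2.inner_def]
  refine integral_congr_ae ?_
  filter_upwards [coeFn_mulC g f, coeFn_mulC (star g) k] with x hf hk
  rw [hf, hk]
  simp only [RCLike.inner_apply, map_mul, ContinuousMap.star_apply, RCLike.star_def]
  ring

theorem star_fourier (n : ℤ) : star (fourier n : C(Torus, ℂ)) = fourier (-n) := by
  ext x
  simp

theorem coeFn_expL2 (n : ℤ) : expL2 n =ᵐ[volume] (fourier n : C(Torus, ℂ)) :=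
  ContinuousMap.coeFn_toLp (p := 2) (𝕜 := ℂ) volume (fourier n)

theorem mulC_fourier_expL2 (k n : ℤ) : mulC (fourier k) (expL2 n) = expL2 (k + n) := by
  apply Lp.ext
  filter_upwards [coeFn_mulC (fourier k) (expL2 n), coeFn_expL2 n, coeFn_expL2 (k + n)]
    with x hk hn hkn
  rw [hk, hn, hkn, fourier_add]

theorem inner_expL2_mulC_fourier (k n : ℤ) (f : L2T) :
    inner ℂ (expL2 n) (mulC (fourier k) f) = inner ℂ (expL2 (n - k)) f := by
  rw [← star_star (fourier k), ← inner_mulC_left, star_fourier, mulC_fourier_expL2,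
    neg_add_eq_sub]

/-- The sine as a continuous function on the torus. -/
def sinC : C(Torus, ℂ) := (Complex.I / 2) • (fourier (-1) - fourier 1)

/-- The cosine as a continuous function on the torus. -/
def cosC : C(Torus, ℂ) := (1 / 2 : ℂ) • (fourier (-1) + fourier 1)

theorem fourier_coe_eq_exp (n : ℤ) (y : ℝ) :
    fourier n (y : Torus) = Complex.exp (n * y * Complex.I) := by
  rw [fourier_coe_apply]
  have hpi : (Real.pi : ℂ) ≠ 0 := Complex.ofReal_ne_zero.mpr Real.pi_pos.ne'
  congr 1
  push_cast
  field_simp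

theorem sinC_apply (x : Torus) : sinC x = sinT x := by
  induction x using QuotientAddGroup.induction_on with
  | H y =>
    change Complex.I / 2 * (fourier (-1) (y : Torus) - fourier 1 (y : Torus)) = (Real.sin y : ℂ)
    rw [fourier_coe_eq_exp, fourier_coe_eq_exp, Complex.ofReal_sin, Complex.sin]
    push_cast
    ring_nf

theorem mulSin_eq_mulC (f : L2T) : mulSin f = mulC sinC f := by
  apply Lp.ext
  filter_upwards [(memLp_sin_mul f).coeFn_toLp, coeFn_mulC sinC f] with x hf hg
  rw [hg, sinC_apply]
  exact hf

/-- Multiplication by `cos y` on `L²`. -/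
def mulCos : L2T →ₗ[ℂ] L2T := mulC cosC

theorem isSymmetric_mulSin : mulSin.IsSymmetric := by
  have hstar : star sinC = sinC := by
    ext x
    rw [ContinuousMap.star_apply, sinC_apply]
    exact Complex.conj_ofReal _
  intro f g
  rw [mulSin_eq_mulC, mulSin_eq_mulC, inner_mulC_left, hstar]

theorem isSymmetric_mulCos : mulCos.IsSymmetric := by
  have hstar : star cosC = cosC := by
    rw [cosC, star_smul, star_add, star_fourier, star_fourier, neg_neg, add_comm]
    simp
  intro f g
  exact (inner_mulC_left cosC f g).trans (by rw [hstar]; rfl)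

theorem inner_expL2_mulSin (n : ℤ) (f : L2T) :
    inner ℂ (expL2 n) (mulSin f) = (Complex.I / 2) *
      (inner ℂ (expL2 (n + 1)) f - inner ℂ (expL2 (n - 1)) f) := by
  simp only [mulSin_eq_mulC, sinC, map_smul, map_sub, smul_apply,
    sub_apply, inner_smul_right, inner_sub_right, inner_expL2_mulC_fourier,
    sub_neg_eq_add]

theorem inner_expL2_mulCos (n : ℤ) (f : L2T) :
    inner ℂ (expL2 n) (mulCos f) = (1 / 2) *
      (inner ℂ (expL2 (n + 1)) f + inner ℂ (expL2 (n - 1)) f) := by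
  simp only [mulCos, cosC, map_smul, map_add, ContinuousLinearMap.coe_coe,
    smul_apply, add_apply, inner_smul_right,
    inner_add_right, inner_expL2_mulC_fourier, sub_neg_eq_add]

theorem mulCos_mulSin (f : L2T) : mulCos (mulSin f) = mulSin (mulCos f) := by
  simp only [mulSin_eq_mulC, mulCos, ContinuousLinearMap.coe_coe, mulC_mulC, mul_comm]

theorem norm_mulSin_sq_add_norm_mulCos_sq (f : L2T) :
    ‖mulSin f‖ ^ 2 + ‖mulCos f‖ ^ 2 = ‖f‖ ^ 2 := by
  have hpyth : mulSin (mulSin f) + mulCos (mulCos f) = f := by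
    refine ext_inner_expL2 fun n => ?_
    rw [inner_add_right]
    simp only [inner_expL2_mulSin, inner_expL2_mulCos, add_sub_cancel_right, sub_add_cancel]
    linear_combination (1 / 4 : ℂ) * (inner ℂ (expL2 (n + 1 + 1)) f - 2 * inner ℂ (expL2 n) f +
      inner ℂ (expL2 (n - 1 - 1)) f) * Complex.I_sq
  rw [← re_inner_self (mulSin f), ← re_inner_self (mulCos f), ← isSymmetric_mulSin (mulSin f) f,
    ← isSymmetric_mulCos (mulCos f) f, ← Complex.add_re, ← inner_add_left, hpyth, re_inner_self]

/-- The graph of the weak derivative. -/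
def weakDerivGraph : Submodule ℂ (L2T × L2T) where
  carrier := {p | IsWeakDeriv p.1 p.2}
  add_mem' := by
    intro p q hp hq
    simp only [Set.mem_ofPred_eq, isWeakDeriv_iff] at *
    intro n
    rw [Prod.snd_add, Prod.fst_add, inner_add_right, inner_add_right, hp, hq]
    ring
  zero_mem' := by
    simp [isWeakDeriv_iff]
  smul_mem' := by
    intro c p hp
    simp only [Set.mem_ofPred_eq, isWeakDeriv_iff] at *
    intro n
    rw [Prod.smul_snd, Prod.smul_fst, inner_smul_right, inner_smul_right, hp]
    ring

theorem mem_weakDerivGraph {f g : L2T} :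
    (f, g) ∈ weakDerivGraph ↔
      ∀ n : ℤ, inner ℂ (expL2 n) g = Complex.I * n * inner ℂ (expL2 n) f :=
  isWeakDeriv_iff f g

theorem inner_weakDeriv {x x' y y' : L2T} (hx : (x, x') ∈ weakDerivGraph)
    (hy : (y, y') ∈ weakDerivGraph) : inner ℂ x' y = -inner ℂ x y' := by
  rw [mem_weakDerivGraph] at hx hy
  rw [← inner_neg_right]
  refine inner_eq_of_inner_expL2 fun n => ?_
  rw [← inner_conj_symm x', hx, inner_neg_right, hy, map_mul, inner_conj_symm]
  simp only [map_mul, Complex.conj_I, map_intCast]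
  ring

theorem weakDeriv_fourierMultiplier {m : ℤ → ℝ} {K : ℝ} (hm : ∀ n, |m n| ≤ K) {x x' : L2T}
    (hx : (x, x') ∈ weakDerivGraph) :
    (fourierMultiplier hm x, fourierMultiplier hm x') ∈ weakDerivGraph := by
  rw [mem_weakDerivGraph] at *
  intro n
  rw [inner_expL2_fourierMultiplier, inner_expL2_fourierMultiplier, hx]
  ring

theorem norm_le_norm_weakDeriv {x x' : L2T} (hx : (x, x') ∈ weakDerivGraph)
    (hmean : inner ℂ (expL2 0) x = 0) : ‖x‖ ≤ ‖x'‖ := by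
  rw [mem_weakDerivGraph] at hx
  rw [← one_mul ‖x'‖]
  refine norm_le_of_norm_inner_expL2_le zero_le_one fun n => ?_
  rcases eq_or_ne n 0 with rfl | hn
  · simp [hmean]
  · rw [hx, norm_mul, norm_mul, Complex.norm_I, one_mul, one_mul, Complex.norm_intCast]
    refine le_mul_of_one_le_left (norm_nonneg _) ?_
    exact_mod_cast Int.one_le_abs hn

theorem exists_weakDeriv_secondDeriv (u : H2) :
    ∃ u₁ : L2T, ((u : L2T), u₁) ∈ weakDerivGraph ∧ (u₁, secondDeriv u) ∈ weakDerivGraph :=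
  (secondDeriv_eq_iff u _).mp rfl

theorem isSinCosPair_mulSin_mulCos : IsSinCosPair weakDerivGraph mulSin mulCos 0 where
  inner_deriv := inner_weakDeriv
  deriv_sin {x x'} hx := by
    rw [mem_weakDerivGraph] at *
    intro n
    rw [inner_add_right]
    simp only [inner_expL2_mulSin, inner_expL2_mulCos, hx]
    push_cast
    linear_combination (1 / 2 : ℂ) * (inner ℂ (expL2 (n + 1)) x + inner ℂ (expL2 (n - 1)) x) *
      Complex.I_sq
  deriv_cos {x x'} hx := by
    rw [mem_weakDerivGraph] at *
    intro n
    rw [inner_sub_right]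
    simp only [inner_expL2_mulSin, inner_expL2_mulCos, hx]
    push_cast
    ring
  sin_symm := isSymmetric_mulSin
  cos_symm := isSymmetric_mulCos
  deriv_comm x := by
    rw [mulCos_mulSin, sub_self]
    exact weakDerivGraph.zero_mem
  comm_nonneg x := by simp
  sq_add_sq_le x := (norm_mulSin_sq_add_norm_mulCos_sq x).le

/-! ### The symmetrised nonlocal operator and its pseudospectral bound -/

/-- The symbol of `(1 - (1 - ∂²)⁻¹)^{1/2}`. -/
def kSymbol (n : ℤ) : ℝ := √((n : ℝ) ^ 2 / (1 + (n : ℝ) ^ 2))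

theorem kSymbol_sq (n : ℤ) : kSymbol n ^ 2 = (n : ℝ) ^ 2 / (1 + (n : ℝ) ^ 2) :=
  Real.sq_sqrt (by positivity)

theorem kSymbol_zero : kSymbol 0 = 0 := by simp [kSymbol]

theorem abs_kSymbol_le (n : ℤ) : |kSymbol n| ≤ 1 := by
  rw [← sq_le_one_iff_abs_le_one, kSymbol_sq, div_le_one (by positivity)]
  linarith

/-- The operator `(1 - (1 - ∂²)⁻¹)^{1/2}`, which turns the norm `‖·‖_*` into the `L²` norm. -/
def sqrtK : L2T →L[ℂ] L2T := fourierMultiplier abs_kSymbol_le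

theorem inner_expL2_sqrtK (f : L2T) (n : ℤ) :
    inner ℂ (expL2 n) (sqrtK f) = kSymbol n * inner ℂ (expL2 n) f :=
  inner_expL2_fourierMultiplier abs_kSymbol_le f n

theorem inner_sqrtK_left (f g : L2T) : inner ℂ (sqrtK f) g = inner ℂ f (sqrtK g) :=
  isSymmetric_fourierMultiplier abs_kSymbol_le f g

/-- Multiplication by `sin y`, symmetrised for the norm `‖·‖_*`. -/
def symSin : L2T →ₗ[ℂ] L2T := sqrtK ∘ₗ mulSin ∘ₗ sqrtK

/-- Multiplication by `cos y`, symmetrised for the norm `‖·‖_*`. -/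
def symCos : L2T →ₗ[ℂ] L2T := sqrtK ∘ₗ mulCos ∘ₗ sqrtK

theorem symSin_apply (f : L2T) : symSin f = sqrtK (mulSin (sqrtK f)) := rfl

theorem symCos_apply (f : L2T) : symCos f = sqrtK (mulCos (sqrtK f)) := rfl

theorem isSymmetric_symSin : symSin.IsSymmetric := fun f g => by
  rw [symSin_apply, symSin_apply, inner_sqrtK_left, isSymmetric_mulSin, inner_sqrtK_left]

theorem isSymmetric_symCos : symCos.IsSymmetric := fun f g => by
  rw [symCos_apply, symCos_apply, inner_sqrtK_left, isSymmetric_mulCos, inner_sqrtK_left]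

theorem inner_expL2_symSin (f : L2T) (n : ℤ) :
    inner ℂ (expL2 n) (symSin f) = Complex.I / 2 * (kSymbol n *
      (kSymbol (n + 1) * inner ℂ (expL2 (n + 1)) f -
        kSymbol (n - 1) * inner ℂ (expL2 (n - 1)) f)) := by
  rw [symSin_apply, inner_expL2_sqrtK, inner_expL2_mulSin, inner_expL2_sqrtK, inner_expL2_sqrtK]
  ring

theorem inner_expL2_symCos (f : L2T) (n : ℤ) :
    inner ℂ (expL2 n) (symCos f) = 1 / 2 * (kSymbol n *
      (kSymbol (n + 1) * inner ℂ (expL2 (n + 1)) f +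
        kSymbol (n - 1) * inner ℂ (expL2 (n - 1)) f)) := by
  rw [symCos_apply, inner_expL2_sqrtK, inner_expL2_mulCos, inner_expL2_sqrtK, inner_expL2_sqrtK]
  ring

/-- The symbol of `∂ [symCos, symSin]`. -/
def commSymbol (n : ℤ) : ℝ := n / 2 * (kSymbol n ^ 2 * (kSymbol (n + 1) ^ 2 - kSymbol (n - 1) ^ 2))

/-- The symbol of `symSin² + symCos²`. -/
def sumSymbol (n : ℤ) : ℝ := 1 / 2 * (kSymbol n ^ 2 * (kSymbol (n + 1) ^ 2 + kSymbol (n - 1) ^ 2))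

theorem commSymbol_eq (n : ℤ) :
    commSymbol n = 2 * (n : ℝ) ^ 4 / ((1 + (n : ℝ) ^ 2) * ((n : ℝ) ^ 4 + 4)) := by
  have hfactor : (n : ℝ) ^ 4 + 4 = (1 + ((n : ℝ) + 1) ^ 2) * (1 + ((n : ℝ) - 1) ^ 2) := by ring
  rw [commSymbol, kSymbol_sq, kSymbol_sq, kSymbol_sq, hfactor]
  push_cast
  field_simp
  ring

theorem sumSymbol_eq (n : ℤ) :
    sumSymbol n = (n : ℝ) ^ 2 * ((n : ℝ) ^ 4 - (n : ℝ) ^ 2 + 2) /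
      ((1 + (n : ℝ) ^ 2) * ((n : ℝ) ^ 4 + 4)) := by
  have hfactor : (n : ℝ) ^ 4 + 4 = (1 + ((n : ℝ) + 1) ^ 2) * (1 + ((n : ℝ) - 1) ^ 2) := by ring
  rw [sumSymbol, kSymbol_sq, kSymbol_sq, kSymbol_sq, hfactor]
  push_cast
  field_simp
  ring

theorem commSymbol_nonneg (n : ℤ) : 0 ≤ commSymbol n := by
  rw [commSymbol_eq]
  positivity

theorem abs_commSymbol_le (n : ℤ) : |commSymbol n| ≤ 2 := by
  rw [abs_of_nonneg (commSymbol_nonneg n), commSymbol_eq, div_le_iff₀ (by positivity)]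
  nlinarith [sq_nonneg ((n : ℝ) ^ 2), mul_nonneg (sq_nonneg (n : ℝ)) (sq_nonneg ((n : ℝ) ^ 2))]

theorem sumSymbol_le (n : ℤ) : sumSymbol n ≤ 1 := by
  rw [sumSymbol_eq, div_le_one (by positivity)]
  nlinarith [sq_nonneg (n : ℝ), sq_nonneg ((n : ℝ) ^ 2)]

theorem one_le_sumSymbol_add {n : ℤ} (hn : n ≠ 0) : 1 ≤ sumSymbol n + 4 * commSymbol n := by
  have hn1 : (1 : ℝ) ≤ (n : ℝ) ^ 2 := by exact_mod_cast Int.add_one_le_of_lt (sq_pos_of_ne_zero hn)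
  rw [sumSymbol_eq, commSymbol_eq, mul_div_assoc', ← add_div, one_le_div (by positivity)]
  nlinarith [show (n : ℝ) ^ 4 = (n : ℝ) ^ 2 * (n : ℝ) ^ 2 by ring]

/-- The operator `∂ [symCos, symSin]`. -/
def commOp : L2T →L[ℂ] L2T := fourierMultiplier abs_commSymbol_le

theorem inner_expL2_commOp (f : L2T) (n : ℤ) :
    inner ℂ (expL2 n) (commOp f) = commSymbol n * inner ℂ (expL2 n) f :=
  inner_expL2_fourierMultiplier abs_commSymbol_le f n

theorem weakDeriv_commutator (f : L2T) :
    (symCos (symSin f) - symSin (symCos f), commOp f) ∈ weakDerivGraph := by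
  rw [mem_weakDerivGraph]
  intro n
  rw [inner_sub_right, inner_expL2_commOp, commSymbol]
  simp only [inner_expL2_symSin, inner_expL2_symCos, add_sub_cancel_right, sub_add_cancel]
  push_cast
  linear_combination (n / 2 * (kSymbol n ^ 2 * (kSymbol (n + 1) ^ 2 - kSymbol (n - 1) ^ 2))) *
    inner ℂ (expL2 n) f * Complex.I_sq

theorem inner_expL2_symSin_sq_add_symCos_sq (f : L2T) (n : ℤ) :
    inner ℂ (expL2 n) (symSin (symSin f) + symCos (symCos f)) =
      sumSymbol n * inner ℂ (expL2 n) f := by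
  rw [inner_add_right, sumSymbol]
  simp only [inner_expL2_symSin, inner_expL2_symCos, add_sub_cancel_right, sub_add_cancel]
  push_cast
  ring_nf
  rw [Complex.I_sq]
  ring

theorem hasSum_norm_symSin_sq_add_norm_symCos_sq (f : L2T) :
    HasSum (fun n : ℤ => sumSymbol n * ((2 * Real.pi)⁻¹ * ‖inner ℂ (expL2 n) f‖ ^ 2))
      (‖symSin f‖ ^ 2 + ‖symCos f‖ ^ 2) := by
  have h := hasSum_re_inner_of_symbol (inner_expL2_symSin_sq_add_symCos_sq f)
  rwa [inner_add_left, isSymmetric_symSin, isSymmetric_symCos, Complex.add_re, re_inner_self,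
    re_inner_self] at h

theorem isSinCosPair_symSin_symCos : IsSinCosPair weakDerivGraph symSin symCos commOp where
  inner_deriv := inner_weakDeriv
  deriv_sin {x x'} hx := by
    rw [mem_weakDerivGraph] at *
    intro n
    rw [inner_add_right]
    simp only [inner_expL2_symSin, inner_expL2_symCos, hx]
    push_cast
    linear_combination 1 / 2 * kSymbol n * (kSymbol (n + 1) * inner ℂ (expL2 (n + 1)) x +
      kSymbol (n - 1) * inner ℂ (expL2 (n - 1)) x) * Complex.I_sq
  deriv_cos {x x'} hx := by
    rw [mem_weakDerivGraph] at *
    intro n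
    rw [inner_sub_right]
    simp only [inner_expL2_symSin, inner_expL2_symCos, hx]
    push_cast
    ring
  sin_symm := isSymmetric_symSin
  cos_symm := isSymmetric_symCos
  deriv_comm := weakDeriv_commutator
  comm_nonneg x :=
    (hasSum_re_inner_of_symbol (inner_expL2_commOp x)).nonneg fun n =>
      mul_nonneg (commSymbol_nonneg n) (by positivity)
  sq_add_sq_le x := by
    refine hasSum_le (fun n => ?_) (hasSum_norm_symSin_sq_add_norm_symCos_sq x) (hasSum_norm_sq x)
    exact mul_le_of_le_one_left (by positivity) (sumSymbol_le n)

theorem sq_norm_le_symSin_symCos_commOp {f : L2T} (hmean : inner ℂ (expL2 0) f = 0) :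
    ‖f‖ ^ 2 ≤ ‖symSin f‖ ^ 2 + ‖symCos f‖ ^ 2 + 4 * (inner ℂ (commOp f) f).re := by
  refine hasSum_le (fun n => ?_) (hasSum_norm_sq f)
    ((hasSum_norm_symSin_sq_add_norm_symCos_sq f).add
      ((hasSum_re_inner_of_symbol (inner_expL2_commOp f)).mul_left 4))
  rcases eq_or_ne n 0 with rfl | hn
  · simp [hmean]
  · rw [← mul_assoc 4, ← add_mul]
    exact le_mul_of_one_le_left (by positivity) (one_le_sumSymbol_add hn)

theorem sub_helmholtzInv_one (f : L2T) : f - helmholtzInv 1 f = sqrtK (sqrtK f) := by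
  refine ext_inner_expL2 fun n => ?_
  rw [inner_sub_right, inner_expL2_helmholtzInv one_pos, inner_expL2_sqrtK, inner_expL2_sqrtK,
    ← mul_assoc, ← Complex.ofReal_mul, ← sq, kSymbol_sq, ← one_sub_mul]
  have hne : (1 + (n : ℂ) ^ 2) ≠ 0 := by
    exact_mod_cast (by positivity : (1 + (n : ℝ) ^ 2) ≠ 0)
  push_cast
  field_simp
  ring

theorem starNorm_eq_norm_sqrtK (f : meanZero) : starNorm f = ‖sqrtK (f : L2T)‖ := by
  rw [starNorm, sub_helmholtzInv_one, ← inner_sqrtK_left, re_inner_self,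
    Real.sqrt_sq (norm_nonneg _)]

theorem expL2_zero : expL2 0 = one := by
  apply Lp.ext
  filter_upwards [coeFn_expL2 0, Lp.coeFn_const 2 (volume : Measure Torus) (1 : ℂ)] with x hx hone
  rw [hx, one, hone]
  simp

theorem mem_meanZero_iff (f : L2T) : f ∈ meanZero ↔ inner ℂ (expL2 0) f = 0 := by
  rw [meanZero_eq, Submodule.mem_orthogonal_singleton_iff_inner_right, expL2_zero]

theorem expL2_mem_meanZero {n : ℤ} (hn : n ≠ 0) : expL2 n ∈ meanZero := by
  rw [mem_meanZero_iff, inner_expL2_expL2, if_neg hn.symm]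

theorem sqrtK_Q1 (f : L2T) : sqrtK (Q1 f : L2T) = sqrtK f := by
  refine ext_inner_expL2 fun n => ?_
  rw [inner_expL2_sqrtK, inner_expL2_sqrtK]
  rcases eq_or_ne n 0 with rfl | hn
  · simp [kSymbol_zero]
  · congr 1
    exact Submodule.inner_orthogonalProjectionOnto_eq_of_mem_left ⟨_, expL2_mem_meanZero hn⟩ f

theorem expL2_mem_H2 (n : ℤ) : expL2 n ∈ H2 := by
  have hderiv : (expL2 n, (Complex.I * n) • expL2 n) ∈ weakDerivGraph := by
    rw [mem_weakDerivGraph]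
    intro m
    rw [inner_smul_right, inner_expL2_expL2]
    split_ifs with h
    · rw [h]
    · simp
  have hderiv2 := weakDerivGraph.smul_mem (Complex.I * n) hderiv
  exact (mem_H2_iff _).mpr ⟨_, _, hderiv, hderiv2⟩

section PerturbedOperator

variable {ν γ kf : ℝ} {k₁ k₃ : ℤ}

theorem sqrtK_opQ1L' (hkf : kf ≠ 0) (hk : (k₁ : ℝ) ^ 2 + (k₃ : ℝ) ^ 2 = kf ^ 2)
    (f : (opQ1L' ν γ kf k₁ k₃).domain) :
    sqrtK (opQ1L' ν γ kf k₁ k₃ f : L2T) =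
      -(((ν * kf ^ 2 : ℝ) : ℂ) • sqrtK (secondDeriv ⟨_, f.2⟩)) +
        (Complex.I * (k₁ / kf ^ 2 * (γ / ν) : ℝ)) • symSin (sqrtK (f : meanZero)) := by
  have happly : opQ1L' ν γ kf k₁ k₃ f = Q1 (-((ν * kf ^ 2 : ℝ) : ℂ) • secondDeriv ⟨_, f.2⟩ +
      (Complex.I * (k₁ / kf ^ 2 * (γ / ν) : ℝ)) • mulSin ((f : meanZero) -
        helmholtzInv (((k₁ : ℝ) ^ 2 + (k₃ : ℝ) ^ 2) / kf ^ 2) (f : meanZero))) := rfl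
  rw [happly, sqrtK_Q1, hk, div_self (by positivity), sub_helmholtzInv_one, map_add, map_smul,
    map_smul, neg_smul, symSin_apply]

theorem le_starNorm_opQ1L'_sub (hν : 0 < ν) (hkf : kf ≠ 0)
    (hk : (k₁ : ℝ) ^ 2 + (k₃ : ℝ) ^ 2 = kf ^ 2) (f : (opQ1L' ν γ kf k₁ k₃).domain) (μ : ℝ) :
    (1 / 32) ^ 4 * √|k₁ * γ| * starNorm f ≤
      starNorm (opQ1L' ν γ kf k₁ k₃ f - (Complex.I * (μ : ℂ)) • (f : meanZero)) := by
  obtain ⟨u₁, hu, hu₁⟩ := exists_weakDeriv_secondDeriv ⟨_, f.2⟩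
  have hmean : inner ℂ (expL2 0) (sqrtK (f : meanZero)) = 0 := by
    rw [inner_expL2_sqrtK, kSymbol_zero]
    simp
  have hg : (sqrtK (f : meanZero), sqrtK u₁) ∈ weakDerivGraph :=
    weakDeriv_fourierMultiplier abs_kSymbol_le hu
  have hab : ν * kf ^ 2 * (k₁ / kf ^ 2 * (γ / ν)) = k₁ * γ := by
    field_simp
  rw [starNorm_eq_norm_sqrtK, starNorm_eq_norm_sqrtK, Submodule.coe_sub, Submodule.coe_smul,
    map_sub, map_smul, sqrtK_opQ1L' hkf hk, ← hab]
  exact isSinCosPair_symSin_symCos.sqrt_abs_mul_norm_le_norm_sub_smul hg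
    (weakDeriv_fourierMultiplier abs_kSymbol_le hu₁) (norm_le_norm_weakDeriv hg hmean)
    (sq_norm_le_symSin_symCos_commOp hmean) (by positivity) _ μ

theorem exists_starNorm_eq_one : ∃ f : meanZero, (f : L2T) ∈ H2 ∧ starNorm f = 1 := by
  have hne : sqrtK (expL2 1) ≠ 0 := by
    intro h
    have hcoef := inner_expL2_sqrtK (expL2 1) 1
    rw [h, inner_zero_right, inner_expL2_expL2, if_pos rfl, ← Complex.ofReal_mul] at hcoef
    have hsymbol := kSymbol_sq 1
    norm_num [(mul_eq_zero.mp (Complex.ofReal_eq_zero.mp hcoef.symm)).resolve_right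
      Real.two_pi_pos.ne'] at hsymbol
  refine ⟨((‖sqrtK (expL2 1)‖⁻¹ : ℝ) : ℂ) • ⟨expL2 1, expL2_mem_meanZero one_ne_zero⟩,
    H2.smul_mem _ (expL2_mem_H2 1), ?_⟩
  rw [starNorm_eq_norm_sqrtK, Submodule.coe_smul, map_smul, norm_smul, Complex.norm_real,
    Real.norm_of_nonneg (by positivity), inv_mul_cancel₀ (norm_ne_zero_iff.mpr hne)]

theorem rpow_le_pseudospectralBound (hν : 0 < ν) (hkf : kf ≠ 0)
    (hk : (k₁ : ℝ) ^ 2 + (k₃ : ℝ) ^ 2 = kf ^ 2) :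
    (1 / 32) ^ 4 * |k₁ * γ| ^ (1 / 2 : ℝ) ≤
      pseudospectralBound starNorm (opQ1L' ν γ kf k₁ k₃) := by
  rw [← Real.sqrt_eq_rpow]
  refine le_csInf ?_ ?_
  · obtain ⟨f, hf, hnorm⟩ := exists_starNorm_eq_one
    exact ⟨_, ⟨f, hf⟩, 0, hnorm, rfl⟩
  · rintro r ⟨f, μ, hf, rfl⟩
    simpa only [hf, mul_one] using le_starNorm_opQ1L'_sub hν hkf hk f μ

end PerturbedOperator

/-! ### The inverse of `L₁` -/

section EnergySystem

variable {F U V S r : ℝ}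

theorem cube_le_of_energy (hF : 0 ≤ F) (hU : 0 ≤ U) (hS : 0 ≤ S) (hSU : S ≤ U)
    (henergy : U ^ 2 + V ^ 2 ≤ F * U) (hinterp : U ^ 2 ≤ 2 * S ^ 2 + 2 * (S * V)) :
    U ^ 3 ≤ 8 * S ^ 2 * F := by
  rcases hU.eq_or_lt with rfl | hU
  · rw [zero_pow three_ne_zero]
    positivity
  have hfactor : U ^ 2 ≤ 2 * S * (U + V) := by nlinarith
  have hsum : (U + V) ^ 2 ≤ 2 * (F * U) := by nlinarith [sq_nonneg (U - V)]
  refine le_of_mul_le_mul_right ?_ hU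
  calc U ^ 3 * U = (U ^ 2) ^ 2 := by ring
    _ ≤ (2 * S * (U + V)) ^ 2 := by gcongr
    _ = 4 * S ^ 2 * (U + V) ^ 2 := by ring
    _ ≤ 4 * S ^ 2 * (2 * (F * U)) := by gcongr
    _ = 8 * S ^ 2 * F * U := by ring

theorem mul_le_of_energy (hF : 0 ≤ F) (hS : 0 ≤ S) (hr : 0 ≤ r)
    (hV : V ^ 2 ≤ F * U) (hcube : U ^ 3 ≤ 8 * S ^ 2 * F)
    (hshear : r ^ 3 * S ^ 2 ≤ F * S + U * V) : r ^ 3 * S ≤ 4 * F := by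
  have hUV : r ^ 3 * (U * V) ≤ 3 * (r ^ 3 * S * F) := by
    refine le_of_sq_le_sq ?_ (by positivity)
    calc (r ^ 3 * (U * V)) ^ 2 = r ^ 6 * U ^ 2 * V ^ 2 := by ring
      _ ≤ r ^ 6 * U ^ 2 * (F * U) := by gcongr
      _ = r ^ 6 * F * U ^ 3 := by ring
      _ ≤ r ^ 6 * F * (8 * S ^ 2 * F) := by gcongr
      _ ≤ (3 * (r ^ 3 * S * F)) ^ 2 := by nlinarith [sq_nonneg (r ^ 3 * S * F)]
  rcases (by positivity : 0 ≤ r ^ 3 * S).eq_or_lt with hzero | hpos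
  · rw [← hzero]
    positivity
  · refine le_of_mul_le_mul_right ?_ hpos
    linarith [mul_le_mul_of_nonneg_left hshear (by positivity : 0 ≤ r ^ 3)]

theorem sq_mul_le_of_energy (hF : 0 ≤ F) (hS : 0 ≤ S) (hr : 0 ≤ r)
    (hcube : U ^ 3 ≤ 8 * S ^ 2 * F) (hmul : r ^ 3 * S ≤ 4 * F) : r ^ 2 * U ≤ 6 * F := by
  refine le_of_pow_le_pow_left₀ three_ne_zero (by positivity) ?_
  calc (r ^ 2 * U) ^ 3 = r ^ 6 * U ^ 3 := by ring
    _ ≤ r ^ 6 * (8 * S ^ 2 * F) := by gcongr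
    _ = 8 * (r ^ 3 * S) ^ 2 * F := by ring
    _ ≤ 8 * (4 * F) ^ 2 * F := by gcongr
    _ ≤ (6 * F) ^ 3 := by nlinarith [pow_nonneg hF 3]

end EnergySystem

section ShearEstimate

variable {u u₁ u₂ f : L2T} {b r : ℝ}

theorem norm_mulCos_le (f : L2T) : ‖mulCos f‖ ≤ ‖f‖ :=
  le_of_sq_le_sq (by linarith [norm_mulSin_sq_add_norm_mulCos_sq f, sq_nonneg ‖mulSin f‖])
    (norm_nonneg f)

theorem sq_norm_le_mulSin (hu : (u, u₁) ∈ weakDerivGraph) :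
    ‖u‖ ^ 2 ≤ 2 * ‖mulSin u‖ ^ 2 + 2 * (‖mulSin u‖ * ‖u₁‖) := by
  have hcos := isSinCosPair_mulSin_mulCos.sq_norm_cos_add_le hu 0
  simp only [LinearMap.zero_apply, inner_zero_left, Complex.zero_re, add_zero,
    Complex.ofReal_zero, zero_smul, sub_zero] at hcos
  linarith [norm_mulSin_sq_add_norm_mulCos_sq u,
    mul_le_mul_of_nonneg_left (norm_mulCos_le u₁) (norm_nonneg (mulSin u))]

theorem norm_le_of_isShearSolution (hu : IsShearSolution weakDerivGraph mulSin 1 b 0 u u₁ u₂ f)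
    (hr : 0 ≤ r) (hb : |b| = r ^ 3) : r ^ 2 * ‖u‖ ≤ 6 * ‖f‖ ∧ r ^ 3 * ‖mulSin u‖ ≤ 4 * ‖f‖ := by
  have henergy := isSinCosPair_mulSin_mulCos.energy_le hu
  have hshear := isSinCosPair_mulSin_mulCos.sq_norm_shift_le hu
  rw [one_mul, add_comm] at henergy
  rw [hb, Complex.ofReal_zero, zero_smul, sub_zero] at hshear
  have hcube := cube_le_of_energy (norm_nonneg f) (norm_nonneg u) (norm_nonneg (mulSin u))
    (isSinCosPair_mulSin_mulCos.norm_sin_le u) henergy (sq_norm_le_mulSin hu.deriv)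
  have hderiv : ‖u₁‖ ^ 2 ≤ ‖f‖ * ‖u‖ := by linarith [sq_nonneg ‖u‖]
  have hmul := mul_le_of_energy (norm_nonneg f) (norm_nonneg (mulSin u)) hr hderiv hcube
    (hshear.trans (by gcongr; exact norm_mulCos_le u))
  exact ⟨sq_mul_le_of_energy (norm_nonneg f) (norm_nonneg _) hr hcube hmul, hmul⟩

end ShearEstimate

theorem isUnit_one_add_smul {A : Type*} [CStarAlgebra A] {Y : A} (hY : IsSelfAdjoint Y) (b : ℝ) :
    IsUnit (1 + (Complex.I * (b : ℂ)) • Y) := by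
  rcases eq_or_ne b 0 with rfl | hb
  · simp
  have hspec : Complex.I / b ∉ spectrum ℂ Y := fun h => by
    have him := hY.im_eq_zero_of_mem_spectrum h
    rw [Complex.div_ofReal_im, Complex.I_im] at him
    exact one_div_ne_zero hb him
  have hb' : (b : ℂ) ≠ 0 := Complex.ofReal_ne_zero.mpr hb
  have hne : -(Complex.I * (b : ℂ)) ≠ 0 := neg_ne_zero.mpr (mul_ne_zero Complex.I_ne_zero hb')
  have hscale : -(Complex.I * (b : ℂ)) * (Complex.I / b) = 1 := by
    field_simp
    rw [Complex.I_sq, neg_neg]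
  convert (spectrum.notMem_iff.mp hspec).smul (Units.mk0 _ hne) using 1
  rw [Units.smul_mk0, Algebra.algebraMap_eq_smul_one, smul_sub, smul_smul, hscale, one_smul]
  module

/-- The symbol of `(1 - ∂²)^{-1/2}`. -/
def invSqrtSymbol (n : ℤ) : ℝ := √((1 + (n : ℝ) ^ 2)⁻¹)

theorem invSqrtSymbol_sq (n : ℤ) : invSqrtSymbol n ^ 2 = (1 + (n : ℝ) ^ 2)⁻¹ :=
  Real.sq_sqrt (by positivity)

theorem abs_invSqrtSymbol_le (n : ℤ) : |invSqrtSymbol n| ≤ 1 := by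
  rw [← sq_le_one_iff_abs_le_one, invSqrtSymbol_sq]
  exact inv_le_one_of_one_le₀ (by linarith [sq_nonneg (n : ℝ)])

/-- The bounded operator `(1 - ∂²)^{-1/2}`. -/
def invSqrt : L2T →L[ℂ] L2T := fourierMultiplier abs_invSqrtSymbol_le

theorem invSqrt_invSqrt (f : L2T) : invSqrt (invSqrt f) = helmholtzInv 1 f := by
  refine ext_inner_expL2 fun n => ?_
  rw [inner_expL2_helmholtzInv one_pos, invSqrt, inner_expL2_fourierMultiplier,
    inner_expL2_fourierMultiplier, ← mul_assoc, ← Complex.ofReal_mul, ← sq, invSqrtSymbol_sq,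
    Complex.ofReal_inv]

theorem isSelfAdjoint_invSqrt_mulC_invSqrt :
    IsSelfAdjoint (invSqrt * mulC sinC * invSqrt) := by
  have hsymm := isSymmetric_fourierMultiplier abs_invSqrtSymbol_le
  rw [ContinuousLinearMap.isSelfAdjoint_iff_isSymmetric]
  intro f g
  change inner ℂ (invSqrt (mulC sinC (invSqrt f))) g = inner ℂ f (invSqrt (mulC sinC (invSqrt g)))
  rw [← mulSin_eq_mulC, ← mulSin_eq_mulC]
  exact (hsymm _ _).trans ((isSymmetric_mulSin _ _).trans (hsymm _ _))

theorem exists_add_helmholtzInv_mulSin_eq (b : ℝ) :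
    ∃ T : L2T →L[ℂ] L2T, ∀ f,
      T f + (Complex.I * (b : ℂ)) • helmholtzInv 1 (mulSin (T f)) = helmholtzInv 1 f := by
  obtain ⟨Z, hZ⟩ :=
    (isUnit_one_add_smul isSelfAdjoint_invSqrt_mulC_invSqrt b).exists_right_inv
  refine ⟨invSqrt * Z * invSqrt, fun f => ?_⟩
  have hf : Z (invSqrt f) + (Complex.I * (b : ℂ)) •
      invSqrt (mulC sinC (invSqrt (Z (invSqrt f)))) = invSqrt f :=
    congrArg (fun A : L2T →L[ℂ] L2T => A (invSqrt f)) hZ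
  rw [← invSqrt_invSqrt, ← invSqrt_invSqrt, mulSin_eq_mulC, ← congrArg invSqrt hf, map_add,
    map_smul]
  rfl

theorem exists_mem_H2_of_helmholtzInv_eq {v g : L2T} (hv : v = helmholtzInv 1 g) :
    ∃ h : v ∈ H2, v - secondDeriv ⟨v, h⟩ = g := by
  obtain ⟨u, hu⟩ := (helmholtz_bijective one_pos).2 g
  obtain rfl : v = u := hv.trans ((helmholtzInv_eq_iff one_pos g u).mpr hu)
  refine ⟨u.2, ?_⟩
  rw [← hu, helmholtz]
  simp

section OperatorL1

variable {ν β : ℝ}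

theorem opL1_apply (u : (opL1 ν β).domain) :
    opL1 ν β u = (ν : ℂ) • secondDeriv u - (ν : ℂ) • (u : L2T) -
      (Complex.I * (β / ν : ℝ)) • mulSin u := rfl

theorem exists_isShearSolution_opL1 (hν : ν ≠ 0) (u : (opL1 ν β).domain) :
    ∃ u₁, IsShearSolution weakDerivGraph mulSin 1 (β / ν ^ 2) 0 u u₁ (secondDeriv u)
      (-(ν : ℂ)⁻¹ • opL1 ν β u) := by
  obtain ⟨u₁, hu, hu₁⟩ := exists_weakDeriv_secondDeriv u
  refine ⟨u₁, hu, hu₁, ?_⟩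
  have hν' : (ν : ℂ) ≠ 0 := Complex.ofReal_ne_zero.mpr hν
  rw [opL1_apply]
  push_cast
  match_scalars <;> field_simp
  simp

theorem opL1_injective (hν : ν ≠ 0) : Function.Injective (opL1 ν β) := by
  refine (injective_iff_map_eq_zero (opL1 ν β).toFun).mpr fun u hu => ?_
  obtain ⟨u₁, hshear⟩ := exists_isShearSolution_opL1 hν u
  have henergy := isSinCosPair_mulSin_mulCos.energy_le hshear
  rw [show opL1 ν β u = 0 from hu, smul_zero, norm_zero, zero_mul, one_mul] at henergy
  have hzero : ‖(u : L2T)‖ = 0 := by nlinarith [sq_nonneg ‖u₁‖, norm_nonneg (u : L2T)]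
  exact Subtype.ext (norm_eq_zero.mp hzero)

theorem opL1_neg_inv_smul (hν : ν ≠ 0) (u : (opL1 ν β).domain) :
    opL1 ν β (-(ν : ℂ)⁻¹ • u) =
      u - secondDeriv u + (Complex.I * (β / ν ^ 2 : ℝ)) • mulSin u := by
  have hν' : (ν : ℂ) ≠ 0 := Complex.ofReal_ne_zero.mpr hν
  rw [LinearPMap.map_smul, opL1_apply]
  push_cast
  match_scalars <;> field_simp

theorem exists_isBoundedInverse_opL1 (hν : ν ≠ 0) :
    ∃ T : L2T →L[ℂ] L2T, IsBoundedInverse (opL1 ν β) T := by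
  obtain ⟨W, hW⟩ := exists_add_helmholtzInv_mulSin_eq (β / ν ^ 2)
  have hright (f : L2T) : ∃ h : (-(ν : ℂ)⁻¹ • W) f ∈ H2, opL1 ν β ⟨(-(ν : ℂ)⁻¹ • W) f, h⟩ = f := by
    obtain ⟨hmem, heq⟩ := exists_mem_H2_of_helmholtzInv_eq
      (v := W f) (g := f - (Complex.I * (β / ν ^ 2 : ℝ)) • mulSin (W f))
      (by rw [map_sub, map_smul, ← hW f, add_sub_cancel_right])
    exact ⟨H2.smul_mem _ hmem,
      (opL1_neg_inv_smul hν ⟨W f, hmem⟩).trans (eq_sub_iff_add_eq.mp heq)⟩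
  refine ⟨-(ν : ℂ)⁻¹ • W, fun u => ?_, hright⟩
  obtain ⟨h, heq⟩ := hright (opL1 ν β u)
  exact congrArg Subtype.val (opL1_injective hν heq)

end OperatorL1

/-! ### The `L¹` bound -/

theorem norm_sq_eq_integral (f : L2T) : ‖f‖ ^ 2 = ∫ y : Torus, ‖f y‖ ^ 2 := by
  have hpt (y : Torus) : inner ℂ (f y) (f y) = ((‖f y‖ ^ 2 : ℝ) : ℂ) := by
    rw [inner_self_eq_norm_sq_to_K]
    norm_cast
  rw [← re_inner_self, L2.inner_def]
  simp only [hpt]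
  rw [integral_complex_ofReal, Complex.ofReal_re]

theorem sq_integral_norm_le (φ : C(Torus, ℂ)) (hφ : ∀ y, φ y ≠ 0) (f : L2T) :
    (∫ y : Torus, ‖f y‖) ^ 2 ≤ (∫ y : Torus, (‖φ y‖ ^ 2)⁻¹) * ‖mulC φ f‖ ^ 2 := by
  have hcont : Continuous fun y => ‖φ y‖⁻¹ :=
    φ.continuous.norm.inv₀ fun y => norm_ne_zero_iff.mpr (hφ y)
  have hinv : MemLp (fun y => ‖φ y‖⁻¹) (ENNReal.ofReal 2) (volume : Measure Torus) :=
    hcont.memLp_of_hasCompactSupport (HasCompactSupport.of_compactSpace _)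
  have hmul : MemLp (fun y => ‖mulC φ f y‖) (ENNReal.ofReal 2) (volume : Measure Torus) := by
    rw [ENNReal.ofReal_ofNat]
    exact (Lp.memLp (mulC φ f)).norm
  have hnorm : ∫ y : Torus, ‖f y‖ = ∫ y, ‖φ y‖⁻¹ * ‖mulC φ f y‖ := by
    refine integral_congr_ae ?_
    filter_upwards [coeFn_mulC φ f] with y hy
    rw [hy, norm_mul, inv_mul_cancel_left₀ (norm_ne_zero_iff.mpr (hφ y))]
  have hholder := integral_mul_le_Lp_mul_Lq_of_nonneg Real.HolderConjugate.two_two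
    (Filter.Eventually.of_forall fun y => inv_nonneg.mpr (norm_nonneg (φ y)))
    (Filter.Eventually.of_forall fun y => norm_nonneg (mulC φ f y)) hinv hmul
  simp only [Real.rpow_two, inv_pow, ← Real.sqrt_eq_rpow, ← hnorm, ← norm_sq_eq_integral] at hholder
  rw [Real.sqrt_sq (norm_nonneg _)] at hholder
  calc (∫ y : Torus, ‖f y‖) ^ 2 ≤ (√(∫ y : Torus, (‖φ y‖ ^ 2)⁻¹) * ‖mulC φ f‖) ^ 2 :=
        pow_le_pow_left₀ (integral_nonneg fun y => norm_nonneg _) hholder 2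
    _ = (∫ y : Torus, (‖φ y‖ ^ 2)⁻¹) * ‖mulC φ f‖ ^ 2 := by
        rw [mul_pow, Real.sq_sqrt (integral_nonneg fun y => by positivity)]

section Weight

variable {δ : ℝ}

theorem inv_sq_add_sin_sq_le (hδ : δ ≠ 0) {y : ℝ} (hy : |y| ≤ Real.pi / 2) :
    (δ ^ 2 + Real.sin y ^ 2)⁻¹ ≤ (δ ^ 2)⁻¹ * (1 + (2 / (Real.pi * δ) * y) ^ 2)⁻¹ := by
  have hjordan := Real.mul_abs_le_abs_sin hy
  have hsq : (2 / Real.pi * |y|) ^ 2 ≤ Real.sin y ^ 2 := by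
    rw [← sq_abs (Real.sin y)]
    gcongr
  rw [← mul_inv]
  refine inv_anti₀ (by positivity) ?_
  calc δ ^ 2 * (1 + (2 / (Real.pi * δ) * y) ^ 2) = δ ^ 2 + (2 / Real.pi * |y|) ^ 2 := by
        rw [mul_pow (2 / Real.pi), sq_abs]
        field_simp
    _ ≤ δ ^ 2 + Real.sin y ^ 2 := by gcongr

theorem continuous_inv_sq_add_sin_sq (hδ : δ ≠ 0) :
    Continuous fun y : ℝ => (δ ^ 2 + Real.sin y ^ 2)⁻¹ :=
  Continuous.inv₀ (by fun_prop) fun y => by positivity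

theorem integral_inv_sq_add_sin_sq_le (hδ : 0 < δ) :
    ∫ y in (-(Real.pi / 2))..Real.pi / 2, (δ ^ 2 + Real.sin y ^ 2)⁻¹ ≤ 5 / δ := by
  have hcont : Continuous fun y : ℝ => (δ ^ 2)⁻¹ * (1 + (2 / (Real.pi * δ) * y) ^ 2)⁻¹ :=
    continuous_const.mul (Continuous.inv₀ (by fun_prop) fun y => by positivity)
  have harg : 2 / (Real.pi * δ) * (Real.pi / 2) = δ⁻¹ := by field_simp
  calc ∫ y in (-(Real.pi / 2))..Real.pi / 2, (δ ^ 2 + Real.sin y ^ 2)⁻¹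
      ≤ ∫ y in (-(Real.pi / 2))..Real.pi / 2,
          (δ ^ 2)⁻¹ * (1 + (2 / (Real.pi * δ) * y) ^ 2)⁻¹ :=
        intervalIntegral.integral_mono_on (by linarith [Real.pi_pos])
          ((continuous_inv_sq_add_sin_sq hδ.ne').intervalIntegrable _ _)
          (hcont.intervalIntegrable _ _)
          fun y hy => inv_sq_add_sin_sq_le hδ.ne' (abs_le.mpr hy)
    _ = Real.pi * Real.arctan δ⁻¹ / δ := by
        rw [intervalIntegral.integral_const_mul,
          intervalIntegral.integral_comp_mul_left (fun t => (1 + t ^ 2)⁻¹) (by positivity),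
          integral_inv_one_add_sq, mul_neg, harg, Real.arctan_neg, smul_eq_mul]
        field_simp
        ring
    _ ≤ 5 / δ := by
        gcongr
        nlinarith [Real.arctan_lt_pi_div_two δ⁻¹, Real.pi_lt_d2, Real.pi_pos]

theorem integral_torus_inv_sq_add_sin_sq_le (hδ : 0 < δ) :
    ∫ y : Torus, (δ ^ 2 + sinT y ^ 2)⁻¹ ≤ 10 / δ := by
  have hint := (continuous_inv_sq_add_sin_sq hδ.ne').intervalIntegrable (μ := volume)
  have hperiodic : Function.Periodic (fun y => (δ ^ 2 + Real.sin y ^ 2)⁻¹) Real.pi := fun y => by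
    simp only [Real.sin_add_pi, neg_sq]
  have hshift := hperiodic.intervalIntegral_add_eq (Real.pi / 2) (-(Real.pi / 2))
  rw [show -(Real.pi / 2) + Real.pi = Real.pi / 2 by ring] at hshift
  calc ∫ y : Torus, (δ ^ 2 + sinT y ^ 2)⁻¹
      = ∫ y in (-(Real.pi / 2))..(-(Real.pi / 2) + 2 * Real.pi), (δ ^ 2 + Real.sin y ^ 2)⁻¹ :=
        (AddCircle.intervalIntegral_preimage (2 * Real.pi) (-(Real.pi / 2)) _).symm
    _ = 2 * ∫ y in (-(Real.pi / 2))..Real.pi / 2, (δ ^ 2 + Real.sin y ^ 2)⁻¹ := by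
        rw [show -(Real.pi / 2) + 2 * Real.pi = Real.pi / 2 + Real.pi by ring,
          ← intervalIntegral.integral_add_adjacent_intervals (hint _ _) (hint (Real.pi / 2) _),
          hshift, two_mul]
    _ ≤ 10 / δ := by
        linarith [integral_inv_sq_add_sin_sq_le hδ, show 10 / δ = 2 * (5 / δ) by ring]

theorem norm_smul_add_I_smul_sq {S : L2T →ₗ[ℂ] L2T} (hS : S.IsSymmetric) (δ : ℝ) (f : L2T) :
    ‖(δ : ℂ) • f + Complex.I • S f‖ ^ 2 = δ ^ 2 * ‖f‖ ^ 2 + ‖S f‖ ^ 2 := by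
  have hcross : (inner ℂ f (S f)).im = 0 := by
    rw [← hS f f]
    exact im_inner_apply_self hS f
  rw [norm_add_sq (𝕜 := ℂ), inner_smul_left, inner_smul_right, norm_smul, norm_smul,
    Complex.norm_real, Complex.norm_I, mul_pow, Real.norm_eq_abs, sq_abs]
  simp [hcross]

theorem mulC_one (f : L2T) : mulC 1 f = f := by
  apply Lp.ext
  filter_upwards [coeFn_mulC 1 f] with y hy
  rw [hy, ContinuousMap.one_apply, one_mul]

theorem sq_integral_norm_le_mulSin (hδ : 0 < δ) (f : L2T) :
    (∫ y : Torus, ‖f y‖) ^ 2 ≤ 10 / δ * (δ ^ 2 * ‖f‖ ^ 2 + ‖mulSin f‖ ^ 2) := by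
  let φ : C(Torus, ℂ) := (δ : ℂ) • 1 + Complex.I • sinC
  have hφ (y : Torus) : ‖φ y‖ ^ 2 = δ ^ 2 + sinT y ^ 2 := by
    have hval : φ y = δ + sinT y * Complex.I := by simp [φ, sinC_apply, mul_comm]
    rw [hval, Complex.sq_norm, Complex.normSq_add_mul_I]
  have hne (y : Torus) : φ y ≠ 0 := by
    rw [← norm_ne_zero_iff, ← pow_ne_zero_iff two_ne_zero, hφ]
    positivity
  have hmul : mulC φ f = (δ : ℂ) • f + Complex.I • mulSin f := by
    rw [mulSin_eq_mulC, map_add, map_smul, map_smul, add_apply, smul_apply, smul_apply, mulC_one]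
  refine (sq_integral_norm_le φ hne f).trans ?_
  simp only [hφ]
  rw [hmul, norm_smul_add_I_smul_sq isSymmetric_mulSin]
  gcongr
  exact integral_torus_inv_sq_add_sin_sq_le hδ

end Weight

theorem integral_norm_le_of_isShearSolution {u u₁ u₂ f : L2T} {b q : ℝ}
    (hu : IsShearSolution weakDerivGraph mulSin 1 b 0 u u₁ u₂ f) (hq : 0 < q)
    (hb : |b| = q ^ 6) : q ^ 5 * ∫ y : Torus, ‖u y‖ ≤ 23 * ‖f‖ := by
  obtain ⟨hnorm, hsin⟩ := norm_le_of_isShearSolution (r := q ^ 2) hu (by positivity)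
    (by rw [hb]; ring)
  refine le_of_sq_le_sq ?_ (by positivity)
  calc (q ^ 5 * ∫ y : Torus, ‖u y‖) ^ 2 = q ^ 10 * (∫ y : Torus, ‖u y‖) ^ 2 := by ring
    _ ≤ q ^ 10 * (10 / (q ^ 2)⁻¹ * ((q ^ 2)⁻¹ ^ 2 * ‖u‖ ^ 2 + ‖mulSin u‖ ^ 2)) := by
        gcongr
        exact sq_integral_norm_le_mulSin (by positivity) u
    _ = 10 * (((q ^ 2) ^ 2 * ‖u‖) ^ 2 + ((q ^ 2) ^ 3 * ‖mulSin u‖) ^ 2) := by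
        field_simp
    _ ≤ 10 * ((6 * ‖f‖) ^ 2 + (4 * ‖f‖) ^ 2) := by gcongr
    _ ≤ (23 * ‖f‖) ^ 2 := by nlinarith [sq_nonneg ‖f‖]

theorem exists_pos_pow_eq {n : ℕ} (hn : n ≠ 0) {x : ℝ} (hx : 0 < x) : ∃ r : ℝ, 0 < r ∧ r ^ n = x :=
  (exists_nonneg_pow_eq hn hx.le).imp fun _ hr =>
    ⟨hr.1.lt_of_ne' fun h => hx.ne (by rw [← hr.2, h, zero_pow hn]), hr.2⟩

theorem le_rpow_neg_div_mul {x y z : ℝ} (hx : 0 < x) (m : ℕ) {n : ℕ} (hn : n ≠ 0)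
    (h : x ^ m * y ≤ z) : y ≤ (x ^ n) ^ (-(m / n) : ℝ) * z := by
  rw [Real.rpow_neg (by positivity), ← Real.rpow_natCast x n, ← Real.rpow_mul hx.le,
    mul_div_cancel₀ _ (Nat.cast_ne_zero.mpr hn), Real.rpow_natCast]
  exact (le_inv_mul_iff₀ (by positivity)).mpr h

/-- Dividing by `ν` makes `ν u'' - ν u - (iβ / ν) sin y u = f` dimensionless with parameter
`β / ν ^ 2`; this undoes the scaling in a bound with exponent `-a`. -/
theorem rpow_div_sq_mul_inv {x ν : ℝ} (hx : 0 ≤ x) (hν : 0 < ν) (a : ℝ) :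
    (x / ν ^ 2) ^ (-a) * ν⁻¹ = x ^ (-a) * ν ^ (2 * a - 1) := by
  rw [Real.div_rpow hx (by positivity), ← Real.rpow_natCast, ← Real.rpow_mul hν.le,
    Real.rpow_sub_one hν.ne', mul_neg, Real.rpow_neg hν.le, Nat.cast_ofNat]
  field_simp

section ScaledBounds

variable {ν β : ℝ}

theorem rpow_mul_norm_inv_smul (hν : 0 < ν) (a : ℝ) (f : L2T) :
    |β / ν ^ 2| ^ (-a) * ‖-(ν : ℂ)⁻¹ • f‖ = |β| ^ (-a) * ν ^ (2 * a - 1) * ‖f‖ := by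
  rw [norm_smul, norm_neg, norm_inv, Complex.norm_of_nonneg hν.le, abs_div,
    abs_of_pos (pow_pos hν 2), ← mul_assoc, rpow_div_sq_mul_inv (abs_nonneg β) hν]

theorem norm_le_of_opL1 (hν : 0 < ν) (hβ : β ≠ 0) (u : (opL1 ν β).domain) :
    ‖(u : L2T)‖ ≤ 6 * |β| ^ (-(2 / 3) : ℝ) * ν ^ (1 / 3 : ℝ) * ‖opL1 ν β u‖ := by
  obtain ⟨r, hr, hrβ⟩ := exists_pos_pow_eq three_ne_zero
    (abs_pos.mpr (div_ne_zero hβ (pow_ne_zero 2 hν.ne')))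
  obtain ⟨u₁, hu⟩ := exists_isShearSolution_opL1 hν.ne' u
  have hnorm := le_rpow_neg_div_mul hr 2 three_ne_zero
    (norm_le_of_isShearSolution hu hr.le hrβ.symm).1
  have hscale := rpow_mul_norm_inv_smul (β := β) hν (2 / 3) (opL1 ν β u)
  rw [hrβ] at hnorm
  norm_num at hnorm hscale ⊢
  linarith

theorem integral_norm_le_of_opL1 (hν : 0 < ν) (hβ : β ≠ 0) (u : (opL1 ν β).domain) :
    ∫ y : Torus, ‖(u : L2T) y‖ ≤
      23 * |β| ^ (-(5 / 6) : ℝ) * ν ^ (2 / 3 : ℝ) * ‖opL1 ν β u‖ := by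
  obtain ⟨q, hq, hqβ⟩ := exists_pos_pow_eq (n := 6) (by norm_num)
    (abs_pos.mpr (div_ne_zero hβ (pow_ne_zero 2 hν.ne')))
  obtain ⟨u₁, hu⟩ := exists_isShearSolution_opL1 hν.ne' u
  have hnorm := le_rpow_neg_div_mul hq 5 (n := 6) (by norm_num)
    (integral_norm_le_of_isShearSolution hu hq hqβ.symm)
  have hscale := rpow_mul_norm_inv_smul (β := β) hν (5 / 6) (opL1 ν β u)
  rw [hqβ] at hnorm
  norm_num at hnorm hscale ⊢
  linarith

end ScaledBounds

/-! ### The lower bound -/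

namespace IsSinCosPair

variable {E : Type*} [NormedAddCommGroup E] [InnerProductSpace ℂ E]
  {D : Submodule ℂ (E × E)} {S C P : E →ₗ[ℂ] E} {ψ u u₁ u₂ f : E} {k b r : ℝ}

theorem mul_sq_norm_sin_le (h : IsSinCosPair D S C P) (hψ : (ψ, -(k : ℂ) • S ψ) ∈ D) :
    2 * k * ‖S ψ‖ ^ 2 ≤ ‖ψ‖ ^ 2 := by
  have hparts := congrArg Complex.re (h.inner_deriv (h.deriv_sin hψ) hψ)
  rw [map_smul, inner_add_left, inner_smul_left, inner_smul_right, h.sin_symm (S ψ)] at hparts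
  simp only [map_neg, Complex.conj_ofReal, Complex.add_re, Complex.neg_re, neg_mul,
    Complex.re_ofReal_mul, neg_neg, re_inner_self] at hparts
  have hcos : (inner ℂ (C ψ) ψ).re ≤ ‖ψ‖ ^ 2 := by
    rw [sq]
    refine ((le_abs_self _).trans (abs_re_inner_le _ _)).trans ?_
    gcongr
    exact le_of_sq_le_sq (by linarith [h.sq_add_sq_le ψ, sq_nonneg ‖S ψ‖]) (norm_nonneg ψ)
  linarith

theorem norm_inner_le_of_isShearSolution (h : IsSinCosPair D S C P)
    (hψ : (ψ, -((r ^ 2 : ℝ) : ℂ) • S ψ) ∈ D) (hu : IsShearSolution D S 1 b 0 u u₁ u₂ f)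
    (hr : 0 < r) (hb : |b| = r ^ 3) : ‖inner ℂ ψ f‖ ≤ ‖ψ‖ * (2 * r * ‖u₁‖ + ‖u‖) := by
  have hderiv : ‖-((r ^ 2 : ℝ) : ℂ) • S ψ‖ ≤ r * ‖ψ‖ := by
    rw [norm_smul, norm_neg, Complex.norm_of_nonneg (sq_nonneg r)]
    refine le_of_sq_le_sq ?_ (by positivity)
    nlinarith [mul_le_mul_of_nonneg_left (h.mul_sq_norm_sin_le hψ) (sq_nonneg r),
      sq_nonneg (r * ‖ψ‖)]
  have hdiffusion : ‖inner ℂ ψ u₂‖ ≤ r * ‖ψ‖ * ‖u₁‖ := by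
    rw [← norm_neg, ← h.inner_deriv hψ hu.deriv_deriv]
    exact (norm_inner_le_norm _ _).trans (by gcongr)
  have hshear : |b| * ‖inner ℂ ψ (S u)‖ ≤ r * ‖ψ‖ * ‖u₁‖ := by
    have hparts := congrArg norm (h.inner_deriv hψ hu.deriv)
    rw [inner_smul_left, norm_mul, norm_neg, RCLike.norm_conj, norm_neg,
      Complex.norm_of_nonneg (sq_nonneg r), h.sin_symm] at hparts
    rw [hb, show r ^ 3 = r * r ^ 2 by ring, mul_assoc, hparts, mul_assoc]
    gcongr
    exact norm_inner_le_norm _ _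
  have hsplit : inner ℂ ψ f =
      -inner ℂ ψ u₂ + inner ℂ ψ u + (Complex.I * b) * inner ℂ ψ (S u) := by
    simp [hu.eq]
  calc ‖inner ℂ ψ f‖
      ≤ ‖inner ℂ ψ u₂‖ + ‖inner ℂ ψ u‖ + |b| * ‖inner ℂ ψ (S u)‖ := by
        rw [hsplit]
        refine (norm_add₃_le ..).trans_eq ?_
        rw [norm_neg, norm_mul, norm_mul, Complex.norm_I, one_mul, Complex.norm_real,
          Real.norm_eq_abs]
    _ ≤ r * ‖ψ‖ * ‖u₁‖ + ‖ψ‖ * ‖u‖ + r * ‖ψ‖ * ‖u₁‖ := by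
        gcongr
        exact norm_inner_le_norm _ _
    _ = ‖ψ‖ * (2 * r * ‖u₁‖ + ‖u‖) := by ring

end IsSinCosPair

theorem integral_torus_eq_intervalIntegral {E : Type*} [NormedAddCommGroup E] [NormedSpace ℝ E]
    (F : Torus → E) : ∫ x, F x = ∫ y in (0 : ℝ)..(2 * Real.pi), F (y : Torus) := by
  rw [← AddCircle.intervalIntegral_preimage (2 * Real.pi) 0 F, zero_add]

theorem inner_expL2_toLp (n : ℤ) (F : C(Torus, ℂ)) :
    inner ℂ (expL2 n) (ContinuousMap.toLp 2 volume ℂ F) =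
      ∫ y in (0 : ℝ)..(2 * Real.pi), F (y : Torus) * fourier (-n) (y : Torus) := by
  rw [L2.inner_def, ← integral_torus_eq_intervalIntegral fun x => F x * fourier (-n) x]
  refine integral_congr_ae ?_
  filter_upwards [coeFn_expL2 n, ContinuousMap.coeFn_toLp (p := 2) (𝕜 := ℂ) volume F] with x hn hF
  rw [hn, hF, RCLike.inner_apply, fourier_neg]

theorem toLp_mem_weakDerivGraph {F F' : C(Torus, ℂ)}
    (hF : ∀ y : ℝ, HasDerivAt (fun t : ℝ => F (t : Torus)) (F' (y : Torus)) y) :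
    (ContinuousMap.toLp 2 volume ℂ F, ContinuousMap.toLp 2 volume ℂ F') ∈ weakDerivGraph := by
  refine mem_weakDerivGraph.mpr fun n => ?_
  have hcont (G : C(Torus, ℂ)) : Continuous fun y : ℝ => G (y : Torus) :=
    G.continuous.comp (AddCircle.continuous_mk' _)
  have hperiod : ((2 * Real.pi : ℝ) : Torus) = ((0 : ℝ) : Torus) := by
    rw [AddCircle.coe_period, AddCircle.coe_zero]
  have hparts := intervalIntegral.integral_mul_deriv_eq_deriv_mul (a := 0) (b := 2 * Real.pi)
    (fun y _ => hF y) (fun y _ => hasDerivAt_exp (-n) y)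
    ((hcont F').intervalIntegrable _ _)
    ((continuous_const.mul (hcont (fourier (-n)))).intervalIntegrable _ _)
  simp only [hperiod, sub_self, zero_sub, mul_left_comm (F _), mul_assoc,
    intervalIntegral.integral_const_mul] at hparts
  rw [inner_expL2_toLp, inner_expL2_toLp]
  push_cast at hparts
  linear_combination hparts

theorem mulSin_toLp (F : C(Torus, ℂ)) :
    mulSin (ContinuousMap.toLp 2 volume ℂ F) = ContinuousMap.toLp 2 volume ℂ (sinC * F) := by
  rw [mulSin_eq_mulC]
  apply Lp.ext
  filter_upwards [coeFn_mulC sinC (ContinuousMap.toLp 2 volume ℂ F),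
    ContinuousMap.coeFn_toLp (p := 2) (𝕜 := ℂ) volume F,
    ContinuousMap.coeFn_toLp (p := 2) (𝕜 := ℂ) volume (sinC * F)] with x hmul hF hprod
  rw [hmul, hF, hprod, ContinuousMap.mul_apply]

theorem cosC_coe (y : ℝ) : cosC (y : Torus) = Real.cos y := by
  change 1 / 2 * (fourier (-1) (y : Torus) + fourier 1 (y : Torus)) = (Real.cos y : ℂ)
  rw [fourier_coe_eq_exp, fourier_coe_eq_exp, Complex.ofReal_cos, Complex.cos]
  push_cast
  ring_nf

section Bump

variable {k r : ℝ}

/-- The test function `exp (k (cos y - 1))`, which concentrates on the scale `k ^ (-1 / 2)` around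
the zero `y = 0` of the sine. -/
def bumpC (k : ℝ) : C(Torus, ℂ) := ⟨fun x => Complex.exp (k * (cosC x - 1)), by fun_prop⟩

theorem bumpC_coe (k y : ℝ) : bumpC k (y : Torus) = Real.exp (k * (Real.cos y - 1)) := by
  change Complex.exp (k * (cosC (y : Torus) - 1)) = _
  rw [cosC_coe]
  push_cast
  rfl

/-- The class of `bumpC` in `L²`. -/
def bump (k : ℝ) : L2T := ContinuousMap.toLp 2 volume ℂ (bumpC k)

theorem bump_mem_weakDerivGraph (k : ℝ) :
    (bump k, -(k : ℂ) • mulSin (bump k)) ∈ weakDerivGraph := by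
  rw [bump, mulSin_toLp, ← map_smul]
  refine toLp_mem_weakDerivGraph fun y => ?_
  simp only [bumpC_coe]
  have hexp := ((((Real.hasDerivAt_cos y).sub_const 1).const_mul k).exp).ofReal_comp
  convert hexp using 1
  change -(k : ℂ) * (sinC (y : Torus) * bumpC k (y : Torus)) = _
  rw [sinC_apply, bumpC_coe, show sinT (y : Torus) = Real.sin y from rfl]
  push_cast
  ring

theorem norm_bump_sq (k : ℝ) :
    ‖bump k‖ ^ 2 = ∫ y in (0 : ℝ)..(2 * Real.pi), Real.exp (k * (Real.cos y - 1)) ^ 2 := by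
  have hnorm : ‖bump k‖ ^ 2 = ∫ x : Torus, ‖bumpC k x‖ ^ 2 := by
    rw [norm_sq_eq_integral]
    refine integral_congr_ae ?_
    filter_upwards [ContinuousMap.coeFn_toLp (p := 2) (𝕜 := ℂ) volume (bumpC k)] with x hx
    rw [bump, hx]
  rw [hnorm, integral_torus_eq_intervalIntegral]
  simp only [bumpC_coe, Complex.norm_real, Real.norm_eq_abs, sq_abs]

theorem inner_one_bump (k : ℝ) : inner ℂ one (bump k) =
    ((∫ y in (0 : ℝ)..(2 * Real.pi), Real.exp (k * (Real.cos y - 1)) : ℝ) : ℂ) := by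
  rw [← expL2_zero, bump, inner_expL2_toLp, ← intervalIntegral.integral_ofReal]
  simp only [neg_zero, fourier_zero, mul_one, bumpC_coe]

theorem sq_norm_bump_le (hk : 0 ≤ k) : ‖bump k‖ ^ 2 ≤ ‖inner ℂ (bump k) one‖ := by
  rw [norm_inner_symm, inner_one_bump, Complex.norm_real, norm_bump_sq]
  refine le_trans ?_ (le_abs_self _)
  refine intervalIntegral.integral_mono Real.two_pi_pos.le
    (Continuous.intervalIntegrable (by fun_prop) _ _)
    (Continuous.intervalIntegrable (by fun_prop) _ _) fun y => ?_
  refine pow_le_of_le_one (Real.exp_pos _).le ?_ two_ne_zero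
  rw [Real.exp_le_one_iff]
  exact mul_nonpos_of_nonneg_of_nonpos hk (by linarith [Real.cos_le_one y])

theorem one_third_le_exp_sq {y : ℝ} (hy : |r * y| ≤ 1) :
    1 / 3 ≤ Real.exp (r ^ 2 * (Real.cos y - 1)) ^ 2 := by
  have hcos := Real.one_sub_sq_div_two_le_cos (x := y)
  have hsq : (r * y) ^ 2 ≤ 1 := (sq_le_one_iff_abs_le_one _).mpr hy
  calc (1 / 3 : ℝ) ≤ Real.exp (-1) := by
        rw [Real.exp_neg, one_div]
        exact inv_anti₀ (Real.exp_pos 1) (by linarith [Real.exp_one_lt_d9])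
    _ ≤ Real.exp (r ^ 2 * (Real.cos y - 1)) ^ 2 := by
        rw [← Real.exp_nat_mul, Real.exp_le_exp]
        push_cast
        nlinarith [sq_nonneg r]

theorem le_sq_norm_bump (hr : 1 ≤ r) : 1 / (3 * r) ≤ ‖bump (r ^ 2)‖ ^ 2 := by
  have hr0 : 0 < r := by linarith
  have hcont : Continuous fun y : ℝ => Real.exp (r ^ 2 * (Real.cos y - 1)) ^ 2 := by fun_prop
  rw [norm_bump_sq]
  calc 1 / (3 * r) = ∫ _ in (0 : ℝ)..r⁻¹, (1 / 3 : ℝ) := by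
        rw [intervalIntegral.integral_const, smul_eq_mul]
        field_simp
        ring
    _ ≤ ∫ y in (0 : ℝ)..r⁻¹, Real.exp (r ^ 2 * (Real.cos y - 1)) ^ 2 := by
        refine intervalIntegral.integral_mono_on (by positivity)
          (continuous_const.intervalIntegrable _ _) (hcont.intervalIntegrable _ _) fun y hy =>
          one_third_le_exp_sq ?_
        rw [abs_of_nonneg (mul_nonneg hr0.le hy.1), ← le_inv_mul_iff₀ hr0, mul_one]
        exact hy.2
    _ ≤ ∫ y in (0 : ℝ)..(2 * Real.pi), Real.exp (r ^ 2 * (Real.cos y - 1)) ^ 2 := by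
        refine intervalIntegral.integral_mono_interval le_rfl (by positivity) ?_
          (Filter.Eventually.of_forall fun y => sq_nonneg _) (hcont.intervalIntegrable _ _)
        linarith [inv_le_one_of_one_le₀ hr, Real.pi_gt_three]

end Bump

theorem le_re_inner_one_of_isShearSolution {u u₁ u₂ : L2T} {b r : ℝ}
    (hu : IsShearSolution weakDerivGraph mulSin 1 b 0 u u₁ u₂ one) (hr : 1 ≤ r)
    (hb : |b| = r ^ 3) : 1 / (15 * r ^ 3) ≤ (inner ℂ u one).re := by
  have hr0 : 0 < r := by linarith
  have hmass := sq_norm_bump_le (sq_nonneg r)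
  have hdual := isSinCosPair_mulSin_mulCos.norm_inner_le_of_isShearSolution
    (bump_mem_weakDerivGraph (r ^ 2)) hu hr0 hb
  have hlower := le_sq_norm_bump hr
  have hpos : 0 < ‖bump (r ^ 2)‖ := by
    refine (norm_nonneg _).lt_of_ne fun h => ?_
    rw [← h, zero_pow two_ne_zero] at hlower
    exact hlower.not_gt (by positivity)
  have hbump : ‖bump (r ^ 2)‖ ≤ r * (2 * ‖u₁‖ + ‖u‖) := by
    refine le_of_mul_le_mul_left ?_ hpos
    nlinarith [mul_le_mul_of_nonneg_right hr (norm_nonneg u)]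
  rw [isSinCosPair_mulSin_mulCos.re_inner_eq_energy hu]
  have hsq : 1 / (3 * r) ≤ r ^ 2 * (5 * (‖u₁‖ ^ 2 + 1 * ‖u‖ ^ 2)) := by
    refine (hlower.trans (pow_le_pow_left₀ hpos.le hbump 2)).trans ?_
    rw [mul_pow]
    gcongr
    nlinarith [sq_nonneg (2 * ‖u‖ - ‖u₁‖)]
  rw [div_le_iff₀ (by positivity)] at hsq ⊢
  linarith

theorem le_norm_inner_one_of_opL1 {ν β : ℝ} (hν : 0 < ν) (hβ : β ≠ 0) (hle : ν ^ 2 ≤ |β|)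
    (u : (opL1 ν β).domain) (hu : opL1 ν β u = one) :
    1 / 15 * ν / |β| ≤ ‖inner ℂ (u : L2T) one‖ := by
  obtain ⟨u₁, hsol⟩ := exists_isShearSolution_opL1 hν.ne' u
  have hν' : (ν : ℂ) ≠ 0 := Complex.ofReal_ne_zero.mpr hν.ne'
  have hscaled := hsol.smul (-ν)
  rw [hu, smul_smul, neg_mul_neg, mul_inv_cancel₀ hν', one_smul] at hscaled
  have habs : |β / ν ^ 2| = |β| / ν ^ 2 := by rw [abs_div, abs_of_pos (pow_pos hν 2)]
  obtain ⟨r, hr, hrβ⟩ := exists_nonneg_pow_eq three_ne_zero (abs_nonneg (β / ν ^ 2))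
  have hr1 : 1 ≤ r := by
    rw [← one_le_pow_iff_of_nonneg hr three_ne_zero, hrβ, habs, one_le_div (by positivity)]
    exact hle
  have henergy := (le_re_inner_one_of_isShearSolution hscaled hr1 hrβ.symm).trans
    (Complex.re_le_norm _)
  rw [inner_smul_left, norm_mul, RCLike.norm_conj, norm_neg, Complex.norm_of_nonneg hν.le, hrβ,
    habs] at henergy
  refine le_of_mul_le_mul_left (le_of_eq_of_le ?_ henergy) hν
  field_simp

end KolmogorovFlow

end

theorem lemma5p4_general :
    ∃ C c : ℝ, 0 < C ∧ 0 < c ∧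
      (∀ ν β : ℝ, 0 < ν → β ≠ 0 →
        ∃ T : KolmogorovFlow.L2T →L[ℂ] KolmogorovFlow.L2T,
          KolmogorovFlow.IsBoundedInverse (KolmogorovFlow.opL1 ν β) T ∧
          (∀ f : KolmogorovFlow.L2T,
            ‖T f‖ ≤ C * |β| ^ (-(2 / 3) : ℝ) * ν ^ (1 / 3 : ℝ) * ‖f‖) ∧
          (∀ f : KolmogorovFlow.L2T,
            ∫ y, ‖(T f : KolmogorovFlow.L2T) y‖ ≤
              C * |β| ^ (-(5 / 6) : ℝ) * ν ^ (2 / 3 : ℝ) * ‖f‖) ∧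
          (ν ^ 2 ≤ |β| →
            c * ν / |β| ≤ ‖inner ℂ (T KolmogorovFlow.one) KolmogorovFlow.one‖)) ∧
      (∀ (ν γ kf : ℝ) (k₁ k₃ : ℤ), 0 < ν → kf ≠ 0 →
        (k₁ : ℝ) ^ 2 + (k₃ : ℝ) ^ 2 = kf ^ 2 →
        c * |k₁ * γ| ^ (1 / 2 : ℝ) ≤
          KolmogorovFlow.pseudospectralBound KolmogorovFlow.starNorm
            (KolmogorovFlow.opQ1L' ν γ kf k₁ k₃)) := by
  refine ⟨23, (1 / 32) ^ 4, by norm_num, by norm_num, fun ν β hν hβ => ?_,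
    fun ν γ kf k₁ k₃ hν hkf hk => KolmogorovFlow.rpow_le_pseudospectralBound hν hkf hk⟩
  obtain ⟨T, hT⟩ := KolmogorovFlow.exists_isBoundedInverse_opL1 (β := β) hν.ne'
  refine ⟨T, hT, fun f => ?_, fun f => ?_, fun hle => ?_⟩
  · obtain ⟨hmem, heq⟩ := hT.2 f
    refine (KolmogorovFlow.norm_le_of_opL1 hν hβ ⟨T f, hmem⟩).trans ?_
    rw [heq]
    gcongr
    norm_num
  · obtain ⟨hmem, heq⟩ := hT.2 f
    exact (KolmogorovFlow.integral_norm_le_of_opL1 hν hβ ⟨T f, hmem⟩).trans_eq (by rw [heq])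
  · obtain ⟨hmem, heq⟩ := hT.2 KolmogorovFlow.one
    refine le_trans ?_ (KolmogorovFlow.le_norm_inner_one_of_opL1 hν hβ hle ⟨_, hmem⟩ heq)
    gcongr ?_ * ν / |β|
    norm_num

theorem lemma5p4 :
    ∃ C c : ℝ, 0 < C ∧ 0 < c ∧
      (∀ ν β : ℝ, 0 < ν → β ≠ 0 →
        ∃ T : KolmogorovFlow.L2T →L[ℂ] KolmogorovFlow.L2T,
          KolmogorovFlow.IsBoundedInverse (KolmogorovFlow.opL1 ν β) T ∧
          (∀ f : KolmogorovFlow.L2T,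
            ‖T f‖ ≤ C * |β| ^ (-(2 / 3) : ℝ) * ν ^ (1 / 3 : ℝ) * ‖f‖) ∧
          (∀ f : KolmogorovFlow.L2T,
            ∫ y, ‖(T f : KolmogorovFlow.L2T) y‖ ≤
              C * |β| ^ (-(5 / 6) : ℝ) * ν ^ (2 / 3 : ℝ) * ‖f‖) ∧
          (ν ^ 2 ≤ |β| →
            c * ν / |β| ≤ ‖inner ℂ (T KolmogorovFlow.one) KolmogorovFlow.one‖)) ∧
      (∀ (ν γ kf : ℝ) (k₁ k₃ : ℤ), 0 < ν → 0 < kf →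
        (k₁ : ℝ) ^ 2 + (k₃ : ℝ) ^ 2 = kf ^ 2 → kf ^ 2 = 1 →
        c * |k₁ * γ| ^ (1 / 2 : ℝ) ≤
          KolmogorovFlow.pseudospectralBound KolmogorovFlow.starNorm
            (KolmogorovFlow.opQ1L' ν γ kf k₁ k₃)) := by
  obtain ⟨C, c, hC, hc, hL1, hL'⟩ := lemma5p4_general
  exact ⟨C, c, hC, hc, hL1, fun ν γ kf k₁ k₃ hν hkf hk _ => hL' ν γ kf k₁ k₃ hν hkf.ne' hk⟩
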